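/- Let $A$ be a finite alphabet. A counter automaton consists of a finite set $Q$ of states, a set $I\subseteq Q$ of initial states, a finite set $\Gamma$ of counters and a set $\delta\subseteq Q\times(A\cup\{\varepsilon\})\times\{\mathbf{nil},\mathbf{inc},\mathbf{reset}\}^{\Gamma}\times Q$ of transitions without nonempty cycles of $\varepsilon$-transitions. All counters start with value $0$, and the value of a counter at a reset is its value just before that reset. Let $T\in\{B,S\}$. As an $\omega T$-automaton, $\mathcal A$ accepts an $\omega$-word $u$ (written $u\in L(\mathcal A)$) if it has a run over $u$ that starts in $I$, resets every counter infinitely often and satisfies the following condition: for $T=B$, all counter values are bounded during the run; for $T=S$, for every counter the values at its successive resets tend to infinity. A $T$-automaton is a counter automaton $\mathcal B$ with a set of final states. A run over a finite word is accepting if it leads from an initial to a final state. For $T=B$, the value of a run is the maximum of the values at resets of counters, and $\mathrm{val}(\mathcal B,w)$ is the minimum of the values of accepting runs over $w$; for $T=S$, the value of a run is the minimum of the values at resets, and $\mathrm{val}(\mathcal B,w)$ is the maximum of the values of accepting runs over $w$ (with $\min\emptyset=\infty$, $\max\emptyset=0$). Let $\widehat{A^*}$ be the space of profinite words, i.e.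 the closure of the image of $A^*$ in the product space $\{0,1\}^{\{K\subseteq A^*\,:\,K\text{ regular}\}}$ under $w\mapsto([w\in K])_K$; words are identified with their images and $\overline K$ denotes the closure of $K\subseteq A^*$ in $\widehat{A^*}$. The language of profinite words recognised by $\mathcal B$ is $\bigcup_{n}\overline{\{w:\mathrm{val}(\mathcal B,w)\le n\}}$ for $T=B$, and $\bigcap_{n}\overline{\{w:\mathrm{val}(\mathcal B,w)>n\}}$ for $T=S$. Languages of this form are called $T$-regular. The transition monoid of $\mathcal A$ is $\mathcal P(Q\times Q)$ with composition of relations, and $h:A^*\to\mathcal P(Q\times Q)$ maps $w$ to the set of pairs $(p,q)$ such that $\mathcal A$ has a run over $w$ from $p$ to $q$. A pair $(s,e)$ of elements of the monoid is linked if $s\cdot e=s$ and $e\cdot e=e$. A sequence of finite words $W=w_0,w_1,\dots$ with $u=w_0w_1\cdots$ is a decomposition of $u$ of type $(s,e)$ if $(s,e)$ is linked, $h(w_0)=s$ and $h(w_n)=e$ for all $n>0$. A grouping of $W$ is a sequence $z_n=w_{i_n}w_{i_n+1}\cdots w_{i_{n+1}-1}$ with $0=i_0<i_1<\cdots$. A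 sequence of finite words strongly converges to $z\in\widehat{A^*}$ if each of its groupings converges to $z$ in $\widehat{A^*}$. **Theorem.** Let $T\in\{B,S\}$, let $\mathcal A$ be an $\omega T$-automaton and let $t=(s,e)$ be a linked pair in its transition monoid. There is a $T$-regular language of profinite words $M_t\subseteq\overline{h^{-1}(e)}\subseteq\widehat{A^*}$ such that for every $\omega$-word $u$ and every decomposition $W$ of $u$ of type $t$ the following conditions are equivalent: 1. $u\in L(\mathcal A)$; 2. some grouping of $W$ strongly converges to some $z\in M_t$; 3. some grouping of $W$ converges to some $z\in M_t$. Moreover, the construction is effective: for each $T$ there is a computable function that maps every code of $\mathcal A,s,e$ (by lists, under any enumeration of letters, states and counters) to a code of a $T$-automaton recognising $M_t$. -/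

import Mathlib

open Filter Topology

namespace CounterAut

/-! ### The monoid of binary relations, linked pairs -/

/-- The monoid `𝒫(Q × Q)` whose product is the composition of relations. -/
def TransMonoid (Q : Type*) : Type _ := Set (Q × Q)

instance {Q : Type*} : Membership (Q × Q) (TransMonoid Q) :=
  inferInstanceAs (Membership (Q × Q) (Set (Q × Q)))

theorem TransMonoid.ext {Q : Type*} {s t : TransMonoid Q} (h : ∀ x, x ∈ s ↔ x ∈ t) : s = t :=
  Set.ext h

instance {Q : Type*} : Monoid (TransMonoid Q) where
  mul s t := {x : Q × Q | ∃ q, (x.1, q) ∈ s ∧ (q, x.2) ∈ t}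
  one := {x : Q × Q | x.1 = x.2}
  mul_assoc s t r := by
    apply TransMonoid.ext
    rintro ⟨p, q⟩
    constructor
    · rintro ⟨y, ⟨x, hx, hy⟩, hr⟩
      exact ⟨x, hx, y, hy, hr⟩
    · rintro ⟨x, hx, y, hy, hr⟩
      exact ⟨y, ⟨x, hx, hy⟩, hr⟩
  one_mul s := by
    apply TransMonoid.ext
    rintro ⟨p, q⟩
    constructor
    · rintro ⟨x, hx, hs⟩
      cases (show p = x from hx)
      exact hs
    · intro hs
      exact ⟨p, rfl, hs⟩
  mul_one s := by
    apply TransMonoid.ext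
    rintro ⟨p, q⟩
    constructor
    · rintro ⟨x, hs, hx⟩
      cases (show x = q from hx)
      exact hs
    · intro hs
      exact ⟨q, hs, rfl⟩

/-- `(s, e)` is a linked pair. -/
def IsLinkedPair {M : Type*} [Monoid M] (s e : M) : Prop :=
  s * e = s ∧ e * e = e

/-! ### Sequences of finite words: decompositions and groupings -/

/-- The finite word `w_i w_{i+1} … w_{j-1}`. -/
def block {A : Type*} (W : ℕ → List A) (i j : ℕ) : List A :=
  ((List.Ico i j).map W).flatten

/-- `u = w_0 w_1 w_2 …`: every `w_0 … w_{n-1}` is a prefix of the ω-word `u`, and the lengths of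
these prefixes are unbounded. -/
def IsDecomposition {A : Type*} (W : ℕ → List A) (u : ℕ → A) : Prop :=
  (∀ n, block W 0 n = (List.range (block W 0 n).length).map u) ∧
    ∀ m, ∃ n, m ≤ (block W 0 n).length

/-- The sequence `W` has type `(s, e)` with respect to `h`. -/
def HasType {A M : Type*} [Monoid M] (h : List A → M) (W : ℕ → List A) (s e : M) : Prop :=
  IsLinkedPair s e ∧ h (W 0) = s ∧ ∀ n, 0 < n → h (W n) = e

/-- `Z` is a grouping of `W`. -/
def IsGrouping {A : Type*} (W Z : ℕ → List A) : Prop :=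
  ∃ i : ℕ → ℕ, i 0 = 0 ∧ StrictMono i ∧ ∀ n, Z n = block W (i n) (i (n + 1))

/-! ### Profinite words -/

/-- Regular languages of finite words over `A`. -/
abbrev RegLang (A : Type*) : Type _ := {K : Language A // K.IsRegular}

open Classical in
/-- The embedding of finite words into `2^(regular languages)`. -/
noncomputable def mu {A : Type*} (w : List A) : RegLang A → Bool :=
  fun K => decide (w ∈ K.1)

/-- Profinite words: the closure of the image of `mu` in the product space
`2^(regular languages)`, with the subspace topology. -/
abbrev ProWord (A : Type*) : Type _ :=
  {x : RegLang A → Bool // x ∈ closure (Set.range (mu (A := A)))}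

/-- A finite word seen as a profinite word. -/
noncomputable def ProWord.ofWord {A : Type*} (w : List A) : ProWord A :=
  ⟨mu w, subset_closure ⟨w, rfl⟩⟩

/-- The topological closure, in the space of profinite words, of a language of finite words. -/
def profClosure {A : Type*} (K : Set (List A)) : Set (ProWord A) :=
  closure (ProWord.ofWord '' K)

/-- The sequence of finite words `Z` converges to the profinite word `z`. -/
def ConvergesTo {A : Type*} (Z : ℕ → List A) (z : ProWord A) : Prop :=
  Tendsto (fun n => ProWord.ofWord (Z n)) atTop (𝓝 z)

/-- The sequence of finite words `Z` strongly converges to the profinite word `z`. -/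
def StronglyConvergesTo {A : Type*} (Z : ℕ → List A) (z : ProWord A) : Prop :=
  ∀ Y, IsGrouping Z Y → ConvergesTo Y z

/-! ### Counter automata -/

/-- The counter operations. -/
inductive CounterOp where
  | nil
  | inc
  | reset

/-- The effect of an operation on the value of a counter. -/
def CounterOp.apply : CounterOp → ℕ → ℕ
  | .nil, v => v
  | .inc, v => v + 1
  | .reset, _ => 0

/-- A transition; the label `none` stands for an ε-transition. -/
structure Transition (A Q Γ : Type*) where
  src : Q
  label : Option A
  op : Γ → CounterOp
  tgt : Q

/-- `ρ` is a sequence of consecutive transitions from `δ` leading from `p` to `q`. -/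
def IsPath {A Q Γ : Type*} (δ : Set (Transition A Q Γ)) :
    Q → List (Transition A Q Γ) → Q → Prop
  | p, [], q => p = q
  | p, t :: ρ, q => t ∈ δ ∧ t.src = p ∧ IsPath δ t.tgt ρ q

/-- The finite word that is read by a finite sequence of transitions. -/
def readWord {A Q Γ : Type*} (ρ : List (Transition A Q Γ)) : List A :=
  ρ.filterMap Transition.label

/-- Counter automata with ε-transitions and without nonempty cycles of ε-transitions.
The sets `Q` of states and `Γ` of counters are meant to be finite. -/
structure CounterAutomaton (A Q Γ : Type*) where
  init : Set Q
  trans : Set (Transition A Q Γ)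
  no_eps_cycle : ∀ p ρ, IsPath trans p ρ p → readWord ρ = [] → ρ = []

/-- Counter automata with final states, to be run on finite words. -/
structure FinCounterAutomaton (A Q Γ : Type*) extends CounterAutomaton A Q Γ where
  final : Set Q

/-- The map from finite words to the transition monoid: `(p, q)` belongs to the image of `w` if
and only if there is a run over `w` from `p` to `q`. -/
def CounterAutomaton.h {A Q Γ : Type*} (𝒜 : CounterAutomaton A Q Γ) (w : List A) :
    TransMonoid Q :=
  {x : Q × Q | ∃ ρ, IsPath 𝒜.trans x.1 ρ x.2 ∧ readWord ρ = w}

/-- The value of the counter `c`, initially `0`, after the transitions in `ρ`. -/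
def counterValue {A Q Γ : Type*} (c : Γ) (ρ : List (Transition A Q Γ)) : ℕ :=
  ρ.foldl (fun v t => (t.op c).apply v) 0

/-- The two modes of acceptance: `B` (bounded) and `S` (strongly unbounded). -/
inductive Mode where
  | B
  | S

/-! ### Automata on ω-words -/

/-- `ρ` is an infinite run over the ω-word `u` that starts in an initial state. -/
def CounterAutomaton.IsOmegaRun {A Q Γ : Type*} (𝒜 : CounterAutomaton A Q Γ)
    (ρ : ℕ → Transition A Q Γ) (u : ℕ → A) : Prop :=
  (ρ 0).src ∈ 𝒜.init ∧ (∀ k, ρ k ∈ 𝒜.trans) ∧ (∀ k, (ρ (k + 1)).src = (ρ k).tgt) ∧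
    IsDecomposition (fun k => (ρ k).label.toList) u

/-- The value of the counter `c` just before the `k`-th transition (counted from `0`) of an
infinite run. -/
def valueBefore {A Q Γ : Type*} (c : Γ) (ρ : ℕ → Transition A Q Γ) (k : ℕ) : ℕ :=
  counterValue c ((List.range k).map ρ)

/-- The condition on counter values in an accepting infinite run: in mode `B` all the values are
bounded; in mode `S` the values before the resets of each counter tend to infinity. -/
def OmegaCondition {A Q Γ : Type*} : Mode → (ℕ → Transition A Q Γ) → Prop
  | .B, ρ => ∃ b : ℕ, ∀ (c : Γ) (k : ℕ), valueBefore c ρ k ≤ b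
  | .S, ρ => ∀ c : Γ,
      Tendsto (valueBefore c ρ) (atTop ⊓ 𝓟 {k | (ρ k).op c = CounterOp.reset}) atTop

/-- The language of ω-words accepted by `𝒜` as an `ωB`-automaton or as an `ωS`-automaton. -/
def CounterAutomaton.omegaLang {A Q Γ : Type*} (T : Mode) (𝒜 : CounterAutomaton A Q Γ) :
    Set (ℕ → A) :=
  {u | ∃ ρ, 𝒜.IsOmegaRun ρ u ∧
    (∀ c : Γ, ∃ᶠ k in atTop, (ρ k).op c = CounterOp.reset) ∧ OmegaCondition T ρ}

/-! ### Automata on finite and profinite words -/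

/-- `ρ` is an accepting run over the finite word `w`. -/
def FinCounterAutomaton.IsAccepting {A Q Γ : Type*} (ℬ : FinCounterAutomaton A Q Γ)
    (ρ : List (Transition A Q Γ)) (w : List A) : Prop :=
  ∃ p ∈ ℬ.init, ∃ q ∈ ℬ.final, IsPath ℬ.trans p ρ q ∧ readWord ρ = w

/-- The values of counters just before they are reset in `ρ`. -/
def resetValues {A Q Γ : Type*} (ρ : List (Transition A Q Γ)) : Set ℕ∞ :=
  {v | ∃ (c : Γ) (k : ℕ) (t : Transition A Q Γ), ρ[k]? = some t ∧ t.op c = CounterOp.reset ∧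
    v = (counterValue c (ρ.take k) : ℕ∞)}

/-- The value of a finite run. -/
noncomputable def runValue {A Q Γ : Type*} : Mode → List (Transition A Q Γ) → ℕ∞
  | .B, ρ => sSup (resetValues ρ)
  | .S, ρ => sInf (resetValues ρ)

/-- The value assigned to a finite word. -/
noncomputable def FinCounterAutomaton.value {A Q Γ : Type*} (ℬ : FinCounterAutomaton A Q Γ) :
    Mode → List A → ℕ∞
  | .B, w => sInf (runValue .B '' {ρ | ℬ.IsAccepting ρ w})
  | .S, w => sSup (runValue .S '' {ρ | ℬ.IsAccepting ρ w})

/-- The language of profinite words recognised by `ℬ` as a `B`-automaton or as an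
`S`-automaton. -/
def FinCounterAutomaton.profLang {A Q Γ : Type*} (ℬ : FinCounterAutomaton A Q Γ) :
    Mode → Set (ProWord A)
  | .B => ⋃ n : ℕ, profClosure {w | ℬ.value .B w ≤ n}
  | .S => ⋂ n : ℕ, profClosure {w | (n : ℕ∞) < ℬ.value .S w}

/-- `M` is recognised by some `T`-automaton. -/
def IsTRegular {A : Type*} (T : Mode) (M : Set (ProWord A)) : Prop :=
  ∃ (Q Γ : Type) (_ : Finite Q) (_ : Finite Γ) (ℬ : FinCounterAutomaton A Q Γ),
    ℬ.profLang T = M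

/-! ### Finite descriptions of automata, for effectiveness -/

/-- The code of a counter operation. -/
def CounterOp.code : CounterOp → ℕ
  | .nil => 0
  | .inc => 1
  | .reset => 2

/-- Codes of transitions: source, label, list of the operations on the successive counters,
target. -/
abbrev TransCode : Type := ℕ × Option ℕ × List ℕ × ℕ

/-- Codes of counter automata: the number of letters, the number of states, the number of
counters, the list of the initial states, the list of the transitions. -/
abbrev AutCode : Type := ℕ × ℕ × ℕ × List ℕ × List TransCode

/-- Codes of counter automata with final states: the second component lists the final states. -/
abbrev FinAutCode : Type := AutCode × List ℕ

/-- The code of a transition under given enumerations of letters, states and counters. -/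
def Transition.code {A Q Γ : Type*} {k n m : ℕ} (α : A ≃ Fin k) (κ : Q ≃ Fin n) (γ : Γ ≃ Fin m)
    (t : Transition A Q Γ) : TransCode :=
  (κ t.src, t.label.map (fun a => (α a : ℕ)), List.ofFn (fun i => (t.op (γ.symm i)).code),
    κ t.tgt)

/-- The list `l` enumerates (in any order, possibly with repetitions) the image of `s`
under `f`. -/
def Lists {X Y : Type*} (l : List Y) (f : X → Y) (s : Set X) : Prop :=
  ∀ y, y ∈ l ↔ ∃ x ∈ s, f x = y

/-- `c` is a code of `𝒜` under the given enumerations of letters, states and counters. -/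
def CounterAutomaton.HasCode {A Q Γ : Type*} {k n m : ℕ} (𝒜 : CounterAutomaton A Q Γ)
    (α : A ≃ Fin k) (κ : Q ≃ Fin n) (γ : Γ ≃ Fin m) (c : AutCode) : Prop :=
  ∃ (I : List ℕ) (D : List TransCode), c = (k, n, m, I, D) ∧
    Lists I (fun q => (κ q : ℕ)) 𝒜.init ∧ Lists D (Transition.code α κ γ) 𝒜.trans

/-- `c` is a code of `ℬ` under the given enumerations of letters, states and counters. -/
def FinCounterAutomaton.HasCode {A Q Γ : Type*} {k n m : ℕ} (ℬ : FinCounterAutomaton A Q Γ)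
    (α : A ≃ Fin k) (κ : Q ≃ Fin n) (γ : Γ ≃ Fin m) (c : FinAutCode) : Prop :=
  ℬ.toCounterAutomaton.HasCode α κ γ c.1 ∧ Lists c.2 (fun q => (κ q : ℕ)) ℬ.final

/-- `l` is a code of the element `s` of the transition monoid under the given enumeration of
states. -/
def TransMonoid.HasCode {Q : Type*} {n : ℕ} (s : TransMonoid Q) (κ : Q ≃ Fin n)
    (l : List (ℕ × ℕ)) : Prop :=
  Lists l (fun x : Q × Q => ((κ x.1 : ℕ), (κ x.2 : ℕ))) {x | x ∈ s}

end CounterAut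

namespace CounterAut

/-! ### Blocks and groupings -/

section Blocks

variable {A : Type*}

/-! An accepting run, cut along a decomposition of type `(s, e)`, eventually consists of loops over
words of value `e` at one state `q` reachable from an initial state by `s`. Whether such loops can
be concatenated into an accepting run can almost be checked loop by loop, up to a threshold `n`; the
words admitting such a loop form `levelLang`, and `typeLang` is the union (`B`) or intersection
(`S`) over `n` of their closures.

The only delicate point is a counter value carried across a cut. In mode `B` each loop ends with an
artificial reset, so all values inside a loop started at `0` are at most `n`, and a carried value
adds at most another bounded amount. In mode `S` each counter follows one of two regimes, recorded
by a mask bit `x`. If `x = false`, every reset inside the loop, the first included, exceeds `n` when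
the loop starts from `0`; carried values only help. If `x = true`, the operations up to the first
reset are ignored, and an artificial final reset demands a large value at the end of the loop, which
serves the first reset of the next loop. By `exists_goodOps_of_tendsto` each counter of an accepting
run fits one of the regimes: its values at the cuts are either unbounded or bounded along a free
ultrafilter.

From a run to a grouping: the ultrafilter fixes the state and the masks, and a Ramsey-type
diagonalisation (`exists_grouping_stronglyConvergesTo`) selects cuts between which all blocks have
the same limit in every regular language and lie in higher and higher levels. Conversely, for fixed
`n`, `q`, `x` the loops form a regular language (`isRegular_loopLang`), whose closure is clopen.
Hence a sequence converging to a point of `typeLang` is eventually made of loops of one kind, with a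
fixed threshold (`B`) or thresholds tending to infinity (`S`), and their concatenation is an
accepting run (`mem_omegaLang_of_grouping`).

For recognisability, an automaton guesses `q` and the masks and simulates one loop while tracking
which counters have been reset and the value of the prefix in the transition monoid. A last
ε-transition performs the artificial resets. The automaton is built directly on codes, so that the
construction is visibly primitive recursive. -/

theorem block_self (W : ℕ → List A) (i : ℕ) : block W i i = [] := by
  simp [block]

theorem block_append (W : ℕ → List A) {i j k : ℕ} (hij : i ≤ j) (hjk : j ≤ k) :
    block W i j ++ block W j k = block W i k := by
  simp only [block, ← List.flatten_append, ← List.map_append, List.Ico.append_consecutive hij hjk]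

theorem block_succ_self (W : ℕ → List A) (i : ℕ) : block W i (i + 1) = W i := by
  simp [block, List.Ico.succ_singleton]

theorem block_succ (W : ℕ → List A) {i j : ℕ} (hij : i ≤ j) :
    block W i (j + 1) = block W i j ++ W j := by
  rw [← block_append W hij (Nat.le_succ j), block_succ_self]

theorem block_block {W Z : ℕ → List A} {i : ℕ → ℕ} (hi : StrictMono i)
    (hZ : ∀ n, Z n = block W (i n) (i (n + 1))) {a b : ℕ} (hab : a ≤ b) :
    block Z a b = block W (i a) (i b) := by
  induction b, hab using Nat.le_induction with
  | base => rw [block_self, block_self]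
  | succ b hab ih =>
    rw [block_succ _ hab, ih, hZ, block_append _ (hi.monotone hab) (hi.monotone b.le_succ)]

theorem isGrouping_refl (W : ℕ → List A) : IsGrouping W W :=
  ⟨id, rfl, strictMono_id, fun n => (block_succ_self W n).symm⟩

theorem StronglyConvergesTo.convergesTo {Z : ℕ → List A} {z : ProWord A}
    (h : StronglyConvergesTo Z z) : ConvergesTo Z z :=
  h Z (isGrouping_refl Z)

end Blocks

/-! ### Regular languages and profinite words -/

section Regular

variable {A : Type*}

/-- Myhill–Nerode: the fibres of `f` refine the right congruence of `L`, so `L` has finitely many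
left quotients. -/
theorem isRegular_of_finite_map {σ : Type*} [Finite σ] (L : Language A) (f : List A → σ)
    (h : ∀ w w', f w = f w' → ∀ v, w ++ v ∈ L → w' ++ v ∈ L) : L.IsRegular := by
  refine .of_finite_range_leftQuotient ?_
  have hf : ∀ w w', f w = f w' → L.leftQuotient w = L.leftQuotient w' := fun w w' hw => by
    ext v
    exact ⟨h w w' hw v, h w' w hw.symm v⟩
  refine (Set.finite_range fun x : Set.range f => L.leftQuotient x.2.choose).subset ?_
  rintro _ ⟨w, rfl⟩
  exact ⟨⟨f w, w, rfl⟩, hf _ _ (Exists.choose_spec (⟨w, rfl⟩ : ∃ y, f y = f w))⟩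

/-- Up to renaming states, an automaton lives on some `Fin n`. Countability lets the diagonal
argument treat all regular languages one after another. -/
instance [Finite A] : Countable (RegLang A) := by
  have : ∀ n : ℕ, Countable (DFA A (Fin n)) := fun n => by
    have hinj : Function.Injective
        (fun M : DFA A (Fin n) => (M.step, M.start, M.accept)) := by
      rintro ⟨_, _, _⟩ ⟨_, _, _⟩ h
      simpa using h
    exact hinj.countable
  let F : (Σ n : ℕ, DFA A (Fin n)) → RegLang A := fun M => ⟨M.2.accepts, _, inferInstance, M.2, rfl⟩
  have hF : Function.Surjective F := by
    rintro ⟨_, σ, _, M, rfl⟩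
    exact ⟨⟨_, M.reindex (Fintype.equivFin σ)⟩, Subtype.ext (by simp [F])⟩
  exact hF.countable

/-- The coordinate at a regular `K` is continuous with discrete values and finite words are dense,
so the closure of `K` is the clopen set where this coordinate is `true`. -/
theorem mem_profClosure_iff {K : Language A} (hK : K.IsRegular) (z : ProWord A) :
    z ∈ profClosure (K : Set (List A)) ↔ z.1 ⟨K, hK⟩ = true := by
  have hcont : Continuous fun z : ProWord A => z.1 ⟨K, hK⟩ :=
    (continuous_apply _).comp continuous_subtype_val
  constructor
  · intro hz
    have hcl : IsClosed {z : ProWord A | z.1 ⟨K, hK⟩ = true} := isClosed_eq hcont continuous_const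
    refine closure_minimal ?_ hcl hz
    rintro _ ⟨w, hw, rfl⟩
    have hw' : w ∈ K := hw
    simp [ProWord.ofWord, mu, hw']
  · intro hz
    have hz' : z ∈ closure (Set.range (ProWord.ofWord (A := A))) := by
      rw [closure_subtype, ← Set.range_comp]
      exact z.2
    refine mem_closure_iff_nhds.2 ?_
    intro U hU
    rw [mem_closure_iff_nhds] at hz'
    have hop : {z : ProWord A | z.1 ⟨K, hK⟩ = true} ∈ 𝓝 z :=
      hcont.continuousAt.eventually ((isOpen_discrete {true}).mem_nhds hz)
    obtain ⟨_, ⟨hxU, hx⟩, w, rfl⟩ := hz' _ (inter_mem hU hop)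
    have hw : w ∈ K := by simpa [ProWord.ofWord, mu] using hx
    exact ⟨_, hxU, w, hw, rfl⟩

theorem ConvergesTo.eventually_mem {Z : ℕ → List A} {z : ProWord A} (h : ConvergesTo Z z)
    {K : Language A} (hK : K.IsRegular) (hz : z ∈ profClosure (K : Set (List A))) :
    ∀ᶠ m in atTop, Z m ∈ K := by
  have hcont : Continuous fun z : ProWord A => z.1 ⟨K, hK⟩ :=
    (continuous_apply _).comp continuous_subtype_val
  have ht := (hcont.tendsto z).comp h
  rw [(mem_profClosure_iff hK z).1 hz, nhds_discrete, tendsto_pure] at ht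
  filter_upwards [ht] with m hm
  simpa [ProWord.ofWord, mu] using hm

theorem ConvergesTo.mem_profClosure {Z : ℕ → List A} {z : ProWord A} (h : ConvergesTo Z z)
    {K : Set (List A)} (hK : ∀ᶠ m in atTop, Z m ∈ K) : z ∈ profClosure K :=
  mem_closure_of_tendsto h (hK.mono fun _ hm => ⟨_, hm, rfl⟩)

/-- Ramsey's theorem by a free ultrafilter. Terms are chosen greedily as pairs (index, level),
keeping the invariant that an index is good, up to its level, with almost every later index. Each
new index is taken from the finitely many large sets produced so far. -/
theorem exists_strictMono_of_eventually (P : ℕ → ℕ → ℕ → Prop)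
    (h : ∀ n, ∀ᶠ i in (hyperfilter ℕ : Filter ℕ), ∀ᶠ j in (hyperfilter ℕ : Filter ℕ), P n i j) :
    ∃ f : ℕ → ℕ, StrictMono f ∧ 0 < f 0 ∧ ∀ n a b, n ≤ a → a < b → P n (f a) (f b) := by
  have hgt : ∀ x : ℕ, ∀ᶠ y in (hyperfilter ℕ : Filter ℕ), x < y := fun x =>
    (eventually_gt_atTop x).filter_mono Nat.hyperfilter_le_atTop
  obtain ⟨g, hg, hr⟩ := exists_seq_of_forall_finset_exists
    (fun p : ℕ × ℕ => 0 < p.1 ∧ ∀ k ≤ p.2, ∀ᶠ j in (hyperfilter ℕ : Filter ℕ), P k p.1 j)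
    (fun p q => p.1 < q.1 ∧ p.2 < q.2 ∧ ∀ k ≤ p.2, P k p.1 q.1) (by
      intro s hs
      obtain ⟨l, hl⟩ : ∃ l, ∀ x ∈ s, x.2 < l :=
        ⟨s.sup Prod.snd + 1, fun x hx => Nat.lt_succ_of_le (Finset.le_sup (f := Prod.snd) hx)⟩
      have h1 : ∀ᶠ y in (hyperfilter ℕ : Filter ℕ),
          ∀ k ∈ Finset.range (l + 1), ∀ᶠ j in (hyperfilter ℕ : Filter ℕ), P k y j :=
        (Finset.eventually_all _).2 fun k _ => h k
      have h2 : ∀ᶠ y in (hyperfilter ℕ : Filter ℕ), ∀ x ∈ s, x.1 < y :=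
        (Finset.eventually_all _).2 fun x _ => hgt x.1
      have h3 : ∀ᶠ y in (hyperfilter ℕ : Filter ℕ), ∀ x ∈ s, ∀ k ∈ Finset.range (x.2 + 1),
          P k x.1 y :=
        (Finset.eventually_all _).2 fun x hx => (Finset.eventually_all _).2 fun k hk =>
          (hs x hx).2 k (Nat.lt_succ_iff.1 (Finset.mem_range.1 hk))
      obtain ⟨y, hy0, hy1, hy2, hy3⟩ := ((hgt 0).and (h1.and (h2.and h3))).exists
      exact ⟨(y, l), ⟨hy0, fun k hk => hy1 k (Finset.mem_range.2 (Nat.lt_succ_of_le hk))⟩,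
        fun x hx => ⟨hy2 x hx, hl x hx, fun k hk =>
          hy3 x hx k (Finset.mem_range.2 (Nat.lt_succ_of_le hk))⟩⟩)
  have hmono : StrictMono fun a => (g a).2 := fun a b hab => (hr a b hab).2.1
  exact ⟨fun a => (g a).1, fun a b hab => (hr a b hab).1, (hg 0).1,
    fun n a b hna hab => (hr a b hab).2.2 n (hna.trans (hmono.id_le a))⟩

/-- Every sequence of words has a strongly converging grouping; moreover its elements can be taken
among the blocks that satisfy a given countable family of almost sure properties. -/
theorem exists_grouping_stronglyConvergesTo [Finite A] (W : ℕ → List A) (P : ℕ → ℕ → ℕ → Prop)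
    (h : ∀ n, ∀ᶠ i in (hyperfilter ℕ : Filter ℕ), ∀ᶠ j in (hyperfilter ℕ : Filter ℕ), P n i j) :
    ∃ Z, IsGrouping W Z ∧ ∃ z, StronglyConvergesTo Z z ∧
      ∀ n, ∀ᶠ m in atTop, ∃ i j, 0 < i ∧ i < j ∧ P n i j ∧ Z m = block W i j := by
  classical
  have : Nonempty (RegLang A) :=
    ⟨⟨⊤, isRegular_of_finite_map ⊤ (fun _ => ()) fun _ _ _ _ h => h⟩⟩
  obtain ⟨K, hK⟩ := exists_surjective_nat (RegLang A)
  let ζ : RegLang A → Bool := fun L => decide (∀ᶠ i in (hyperfilter ℕ : Filter ℕ),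
    ∀ᶠ j in (hyperfilter ℕ : Filter ℕ), block W i j ∈ L.1)
  have hζ : ∀ L, ∀ᶠ i in (hyperfilter ℕ : Filter ℕ), ∀ᶠ j in (hyperfilter ℕ : Filter ℕ),
      mu (block W i j) L = ζ L := by
    intro L
    by_cases hL : ∀ᶠ i in (hyperfilter ℕ : Filter ℕ), ∀ᶠ j in (hyperfilter ℕ : Filter ℕ),
      block W i j ∈ L.1
    · filter_upwards [hL] with i hi
      filter_upwards [hi] with j hj
      simp [mu, ζ, hL, hj]
    · filter_upwards [Ultrafilter.eventually_not.2 hL] with i hi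
      filter_upwards [Ultrafilter.eventually_not.2 hi] with j hj
      simp [mu, ζ, hL, hj]
  obtain ⟨f, hf, hf0, hfP⟩ := exists_strictMono_of_eventually
    (fun n i j => P n i j ∧ mu (block W i j) (K n) = ζ (K n)) fun n => by
      filter_upwards [h n, hζ (K n)] with i h1 h2
      filter_upwards [h1, h2] with j h3 h4
      exact ⟨h3, h4⟩
  -- A grouping must start at `0`, about which the selection says nothing; the first group is
  -- therefore exceptional and ignored in the limit.
  let g : ℕ → ℕ := fun n => Nat.casesOn n 0 f
  have hg : StrictMono g := strictMono_nat_of_lt_succ fun n => by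
    cases n with
    | zero => exact hf0
    | succ n => exact hf n.lt_succ_self
  have hlim : ∀ Y, IsGrouping (fun n => block W (g n) (g (n + 1))) Y → ∀ L,
      ∀ᶠ m in atTop, mu (Y m) L = ζ L := by
    rintro Y ⟨i, hi0, hi, hY⟩ L
    obtain ⟨k, rfl⟩ := hK L
    filter_upwards [eventually_ge_atTop (k + 1)] with m hm
    -- Groups of groups are again blocks between selected indices, so the pairwise property of the
    -- selection gives strong convergence.
    rw [hY, block_block hg (fun _ => rfl) (hi.monotone m.le_succ)]
    have h1 : k + 1 ≤ i m := hm.trans (hi.id_le m)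
    have h2 : i m < i (m + 1) := hi m.lt_succ_self
    obtain ⟨a, ha⟩ : ∃ a, i m = a + 1 := ⟨i m - 1, by omega⟩
    obtain ⟨b, hb⟩ : ∃ b, i (m + 1) = b + 1 := ⟨i (m + 1) - 1, by omega⟩
    rw [ha, hb]
    exact (hfP k a b (by omega) (by omega)).2
  have hz : ζ ∈ closure (Set.range (mu (A := A))) := by
    refine mem_closure_of_tendsto (b := atTop) (tendsto_pi_nhds.2 fun L => ?_)
      (Eventually.of_forall fun m => Set.mem_range_self (block W (g m) (g (m + 1))))
    exact tendsto_const_nhds.congr' ((hlim _ (isGrouping_refl _) L).mono fun _ hm => hm.symm)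
  refine ⟨fun n => block W (g n) (g (n + 1)), ⟨g, rfl, hg, fun _ => rfl⟩, ⟨ζ, hz⟩, ?_, ?_⟩
  · intro Y hY
    refine tendsto_subtype_rng.2 (tendsto_pi_nhds.2 fun L => ?_)
    exact tendsto_const_nhds.congr' ((hlim Y hY L).mono fun _ hm => hm.symm)
  · intro n
    filter_upwards [eventually_ge_atTop (n + 1)] with m hm
    obtain ⟨a, rfl⟩ : ∃ a, m = a + 1 := ⟨m - 1, by omega⟩
    exact ⟨f a, f (a + 1), lt_of_lt_of_le hf0 (hf.monotone a.zero_le), hf a.lt_succ_self,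
      (hfP n a (a + 1) (by omega) a.lt_succ_self).1, rfl⟩

end Regular

/-! ### Sequences of operations on one counter -/

/-- Whether an operation is a reset. -/
def CounterOp.isReset : CounterOp → Bool
  | .reset => true
  | _ => false

theorem CounterOp.isReset_iff (a : CounterOp) : a.isReset = true ↔ a = .reset := by
  cases a <;> simp [CounterOp.isReset]

/-- The value of a counter with initial value `v` after a sequence of operations. -/
def opsValue (v : ℕ) (o : List CounterOp) : ℕ :=
  o.foldl (fun v a => a.apply v) v

/-- The values of a counter with initial value `v` before all its resets satisfy `P`. -/
def AllResets (P : ℕ → Prop) : ℕ → List CounterOp → Prop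
  | _, [] => True
  | v, a :: o => (a.isReset = true → P v) ∧ AllResets P (a.apply v) o

/-- Unless `b` holds, all the operations up to the first reset are disabled. -/
def maskOps : Bool → List CounterOp → List CounterOp
  | _, [] => []
  | b, a :: o => (bif b then a else .nil) :: maskOps (b || a.isReset) o

section Ops

variable {P : ℕ → Prop} {v v' : ℕ} {o o' : List CounterOp}

theorem opsValue_cons (v : ℕ) (a : CounterOp) (o : List CounterOp) :
    opsValue v (a :: o) = opsValue (a.apply v) o := rfl

theorem opsValue_append (v : ℕ) (o o' : List CounterOp) :
    opsValue v (o ++ o') = opsValue (opsValue v o) o' :=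
  List.foldl_append

theorem opsValue_mono (h : v ≤ v') (o : List CounterOp) : opsValue v o ≤ opsValue v' o := by
  induction o generalizing v v' with
  | nil => exact h
  | cons a o ih =>
    refine ih ?_
    cases a <;> simp [CounterOp.apply, h]

theorem opsValue_le_add (v : ℕ) (o : List CounterOp) : opsValue v o ≤ v + opsValue 0 o := by
  induction o using List.reverseRecOn with
  | nil => exact Nat.le_add_right _ _
  | append_singleton o a ih =>
    simp only [opsValue_append]
    cases a <;> simp only [opsValue, CounterOp.apply, List.foldl_cons, List.foldl_nil] at ih ⊢ <;>
      omega

theorem opsValue_eq_of_reset (h : o.any CounterOp.isReset = true) (v v' : ℕ) :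
    opsValue v o = opsValue v' o := by
  induction o generalizing v v' with
  | nil => simp at h
  | cons a o ih =>
    cases a
    · exact ih (by simpa [CounterOp.isReset] using h) _ _
    · exact ih (by simpa [CounterOp.isReset] using h) _ _
    · rfl

theorem le_opsValue_of_no_reset (h : o.any CounterOp.isReset = false) (v : ℕ) :
    v ≤ opsValue v o := by
  induction o generalizing v with
  | nil => exact le_rfl
  | cons a o ih =>
    simp only [List.any_cons, Bool.or_eq_false_iff] at h
    rw [opsValue_cons]
    refine le_trans ?_ (ih h.2 _)
    cases a <;> simp [CounterOp.apply, CounterOp.isReset] at h ⊢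

theorem opsValue_le_length (o : List CounterOp) (v : ℕ) : opsValue v o ≤ v + o.length := by
  induction o generalizing v with
  | nil => exact le_rfl
  | cons a o ih =>
    rw [opsValue_cons]
    refine (ih _).trans ?_
    cases a <;> simp only [CounterOp.apply, List.length_cons] <;> omega

theorem allResets_append (P : ℕ → Prop) (v : ℕ) (o o' : List CounterOp) :
    AllResets P v (o ++ o') ↔ AllResets P v o ∧ AllResets P (opsValue v o) o' := by
  induction o generalizing v with
  | nil => simp [AllResets, opsValue]
  | cons a o ih => simp [AllResets, opsValue_cons, ih, and_assoc]

theorem allResets_singleton (P : ℕ → Prop) (v : ℕ) (a : CounterOp) :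
    AllResets P v [a] ↔ (a.isReset = true → P v) := by
  simp [AllResets]

theorem allResets_iff (P : ℕ → Prop) (v : ℕ) (o : List CounterOp) :
    AllResets P v o ↔ ∀ k, o[k]? = some .reset → P (opsValue v (o.take k)) := by
  induction o generalizing v with
  | nil => simp [AllResets]
  | cons a o ih =>
    simp only [AllResets, ih, CounterOp.isReset_iff]
    constructor
    · rintro ⟨h0, h1⟩ (_ | k) hk
      · exact h0 (by simpa using hk)
      · exact h1 k (by simpa using hk)
    · intro h
      exact ⟨fun ha => h 0 (by simp [ha]), fun k hk => h (k + 1) (by simpa using hk)⟩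

/-- A value decreases only at a reset, and the sequence ends with one; hence every intermediate
value is at most the value at the next reset. -/
theorem opsValue_take_le {b : ℕ} (h : AllResets (· ≤ b) v (o ++ [.reset])) (l : ℕ) :
    opsValue v (o.take l) ≤ b := by
  induction o generalizing v l with
  | nil =>
    simpa [AllResets, opsValue, CounterOp.isReset] using h
  | cons a o ih =>
    have hv : ∀ l, opsValue (a.apply v) (o.take l) ≤ b := ih h.2
    cases l with
    | succ l => exact hv l
    | zero =>
      cases a
      · exact hv 0
      · exact (Nat.le_succ v).trans (hv 0)
      · exact h.1 rfl

theorem maskOps_true (o : List CounterOp) : maskOps true o = o := by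
  induction o with
  | nil => rfl
  | cons a o ih => simp [maskOps, ih]

theorem maskOps_append (b : Bool) (o o' : List CounterOp) :
    maskOps b (o ++ o') = maskOps b o ++ maskOps (b || o.any CounterOp.isReset) o' := by
  induction o generalizing b with
  | nil => simp [maskOps]
  | cons a o ih => simp [maskOps, ih, Bool.or_assoc]

/-- After the first reset the true counter is at `0`, and so is the masked one, which has not moved
from its initial `0`. -/
theorem opsValue_maskOps (h : o.any CounterOp.isReset = true) (b : Bool) :
    opsValue 0 (maskOps b o) = opsValue 0 o := by
  cases b with
  | true => rw [maskOps_true]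
  | false =>
    have key : ∀ v, opsValue 0 (maskOps false o) = opsValue v o := by
      induction o with
      | nil => simp at h
      | cons a o ih =>
        intro v
        cases a
        · exact ih (by simpa [CounterOp.isReset] using h) _
        · exact ih (by simpa [CounterOp.isReset] using h) _
        · simp [maskOps, CounterOp.isReset, maskOps_true, opsValue_cons, CounterOp.apply]
    exact key 0

end Ops

/-! ### Threshold requirements on one counter along a loop -/

/-- The requirement on the values before resets that corresponds to the threshold `n`. -/
def Mode.Admits : Mode → ℕ → ℕ → Prop
  | .B, n, v => v ≤ n
  | .S, n, v => n < v

/-- The final operation on a counter; `x` tells whether the operations up to the first reset of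
that counter are disabled. -/
def Mode.finalOp : Mode → Bool → CounterOp
  | .B, _ => .reset
  | .S, x => bif x then .reset else .nil

/-- The operations on a counter in one loop of a run satisfy the requirement for the
threshold `n`. -/
def GoodOps (T : Mode) (x : Bool) (n : ℕ) (o : List CounterOp) : Prop :=
  o.any CounterOp.isReset = true ∧ AllResets (T.Admits n) 0 (maskOps (!x) o ++ [T.finalOp x])

theorem Mode.admits_min (T : Mode) {n v v' : ℕ} (h : min v (n + 1) = min v' (n + 1)) :
    T.Admits n v ↔ T.Admits n v' := by
  cases T <;> simp only [Mode.Admits] <;> omega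

/-- Truncation at `n + 1` commutes with the operations and keeps all that the threshold `n` can see,
so finitely many values suffice. -/
theorem allResets_min (T : Mode) {n v v' : ℕ} (h : min v (n + 1) = min v' (n + 1))
    (o : List CounterOp) : AllResets (T.Admits n) v o ↔ AllResets (T.Admits n) v' o := by
  induction o generalizing v v' with
  | nil => exact Iff.rfl
  | cons a o ih =>
    have h' : min (a.apply v) (n + 1) = min (a.apply v') (n + 1) := by
      cases a <;> simp only [CounterOp.apply] <;> omega
    simp only [AllResets, T.admits_min h, ih h']

/-- What has to be remembered about an initial part of the operations on a counter. -/
def opsData (T : Mode) (x : Bool) (n : ℕ) (o : List CounterOp) : Bool × Fin (n + 2) × Prop :=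
  (o.any CounterOp.isReset,
    ⟨min (opsValue 0 (maskOps (!x) o)) (n + 1), by omega⟩,
    AllResets (T.Admits n) 0 (maskOps (!x) o))

/-- The finite data `opsData` determine how any continuation will be judged; this is the right
congruence behind the regularity of `loopLang`. -/
theorem GoodOps.congr_left {T : Mode} {x : Bool} {n : ℕ} {o₁ o₂ o : List CounterOp}
    (h : opsData T x n o₁ = opsData T x n o₂) (h₁ : GoodOps T x n (o₁ ++ o)) :
    GoodOps T x n (o₂ ++ o) := by
  simp only [opsData, Prod.mk.injEq, Fin.mk.injEq] at h
  obtain ⟨ha, hv, hr⟩ := h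
  simp only [GoodOps, List.any_append, maskOps_append, List.append_assoc, allResets_append,
    ← ha, ← hr] at h₁ ⊢
  refine ⟨h₁.1, h₁.2.1, ?_⟩
  have := h₁.2.2
  rw [← allResets_append] at this ⊢
  exact (allResets_min T hv _).1 this

theorem GoodOps.antitone {x : Bool} {n n' : ℕ} (h : n ≤ n') {o : List CounterOp}
    (ho : GoodOps .S x n' o) : GoodOps .S x n o :=
  ⟨ho.1, (allResets_iff _ _ _).2 fun k hk =>
    lt_of_le_of_lt h ((allResets_iff _ _ _).1 ho.2 k hk)⟩

/-! ### Paths -/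

section Paths

variable {A Q Γ : Type*} {δ : Set (Transition A Q Γ)}

/-- The operations on a counter in a sequence of transitions. -/
def opsOf (c : Γ) (ρ : List (Transition A Q Γ)) : List CounterOp :=
  ρ.map fun t => t.op c

theorem opsOf_append (c : Γ) (ρ ρ' : List (Transition A Q Γ)) :
    opsOf c (ρ ++ ρ') = opsOf c ρ ++ opsOf c ρ' :=
  List.map_append

theorem counterValue_eq (c : Γ) (ρ : List (Transition A Q Γ)) :
    counterValue c ρ = opsValue 0 (opsOf c ρ) := by
  simp [counterValue, opsValue, opsOf, List.foldl_map]

theorem readWord_append (ρ ρ' : List (Transition A Q Γ)) :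
    readWord (ρ ++ ρ') = readWord ρ ++ readWord ρ' :=
  List.filterMap_append

theorem isPath_append {p q : Q} {ρ ρ' : List (Transition A Q Γ)} :
    IsPath δ p (ρ ++ ρ') q ↔ ∃ r, IsPath δ p ρ r ∧ IsPath δ r ρ' q := by
  induction ρ generalizing p with
  | nil => simp [IsPath]
  | cons t ρ ih =>
    simp only [List.cons_append, IsPath, ih]
    constructor
    · rintro ⟨h1, h2, r, h3, h4⟩
      exact ⟨r, ⟨h1, h2, h3⟩, h4⟩
    · rintro ⟨r, ⟨h1, h2, h3⟩, h4⟩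
      exact ⟨h1, h2, r, h3, h4⟩

theorem exists_path_append {p q : Q} {ρ : List (Transition A Q Γ)} {w v : List A}
    (hρ : IsPath δ p ρ q) (hw : readWord ρ = w ++ v) :
    ∃ r ρ₁ ρ₂, ρ = ρ₁ ++ ρ₂ ∧ IsPath δ p ρ₁ r ∧ IsPath δ r ρ₂ q ∧
      readWord ρ₁ = w ∧ readWord ρ₂ = v := by
  obtain ⟨ρ₁, ρ₂, rfl, h1, h2⟩ := List.filterMap_eq_append_iff.1 hw
  obtain ⟨r, h3, h4⟩ := isPath_append.1 hρ
  exact ⟨r, ρ₁, ρ₂, rfl, h3, h4, h1, h2⟩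

theorem CounterAutomaton.mem_h (𝒜 : CounterAutomaton A Q Γ) {w : List A} {p q : Q} :
    (p, q) ∈ 𝒜.h w ↔ ∃ ρ, IsPath 𝒜.trans p ρ q ∧ readWord ρ = w := Iff.rfl

theorem TransMonoid.mem_mul {s t : TransMonoid Q} {p q : Q} :
    (p, q) ∈ s * t ↔ ∃ r, (p, r) ∈ s ∧ (r, q) ∈ t := Iff.rfl

instance [Finite Q] : Finite (TransMonoid Q) :=
  inferInstanceAs (Finite (Set (Q × Q)))

theorem CounterAutomaton.h_append (𝒜 : CounterAutomaton A Q Γ) (w v : List A) :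
    𝒜.h (w ++ v) = 𝒜.h w * 𝒜.h v := by
  apply TransMonoid.ext
  rintro ⟨p, q⟩
  rw [TransMonoid.mem_mul]
  simp only [CounterAutomaton.mem_h]
  constructor
  · rintro ⟨ρ, hρ, hw⟩
    obtain ⟨r, ρ₁, ρ₂, -, h1, h2, h3, h4⟩ := exists_path_append hρ hw
    exact ⟨r, ⟨ρ₁, h1, h3⟩, ρ₂, h2, h4⟩
  · rintro ⟨r, ⟨ρ₁, h1, h3⟩, ρ₂, h2, h4⟩
    exact ⟨ρ₁ ++ ρ₂, isPath_append.2 ⟨r, h1, h2⟩, by rw [readWord_append, h3, h4]⟩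

theorem h_block_eq_right (𝒜 : CounterAutomaton A Q Γ) {s e : TransMonoid Q} {W : ℕ → List A}
    (h : HasType 𝒜.h W s e) {i j : ℕ} (hi : 0 < i) (hij : i < j) : 𝒜.h (block W i j) = e := by
  induction j, hij using Nat.le_induction with
  | base => rw [block_succ_self]; exact h.2.2 i hi
  | succ j hj ih =>
    rw [block_succ _ (by omega), 𝒜.h_append, ih, h.2.2 j (by omega), h.1.2]

theorem h_block_eq_left (𝒜 : CounterAutomaton A Q Γ) {s e : TransMonoid Q} {W : ℕ → List A}
    (h : HasType 𝒜.h W s e) {j : ℕ} (hj : 0 < j) : 𝒜.h (block W 0 j) = s := by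
  induction j, hj using Nat.le_induction with
  | base => rw [block_succ_self]; exact h.2.1
  | succ j hj ih =>
    rw [block_succ _ (by omega), 𝒜.h_append, ih, h.2.2 j (by omega), h.1.1]

/-- The words `w` with value `e` over which there is a loop at `q` in which all counters fulfil the
requirement for the threshold `n`. -/
def CounterAutomaton.loopLang (𝒜 : CounterAutomaton A Q Γ) (T : Mode) (e : TransMonoid Q) (q : Q)
    (x : Γ → Bool) (n : ℕ) : Language A :=
  {w | 𝒜.h w = e ∧ ∃ ρ, IsPath 𝒜.trans q ρ q ∧ readWord ρ = w ∧
    ∀ c, GoodOps T (x c) n (opsOf c ρ)}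

/-- A subset construction: of a prefix, only its value in the transition monoid and the set of
reachable pairs (state, truncated counter data) matter. -/
theorem CounterAutomaton.isRegular_loopLang [Finite Q] [Finite Γ] (𝒜 : CounterAutomaton A Q Γ)
    (T : Mode) (e : TransMonoid Q) (q : Q) (x : Γ → Bool) (n : ℕ) :
    (𝒜.loopLang T e q x n).IsRegular := by
  refine isRegular_of_finite_map _ (fun w => (𝒜.h w,
    {y : Q × (Γ → Bool × Fin (n + 2) × Prop) | ∃ ρ, IsPath 𝒜.trans q ρ y.1 ∧ readWord ρ = w ∧
      ∀ c, opsData T (x c) n (opsOf c ρ) = y.2 c})) ?_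
  rintro w w' hww v ⟨hh, ρ, hρ, hw, hg⟩
  obtain ⟨h1, h2⟩ := Prod.mk.inj hww
  obtain ⟨r, ρ₁, ρ₂, rfl, h3, h4, h5, h6⟩ := exists_path_append hρ hw
  have hmem : (r, fun c => opsData T (x c) n (opsOf c ρ₁)) ∈
      {y : Q × (Γ → Bool × Fin (n + 2) × Prop) | ∃ ρ, IsPath 𝒜.trans q ρ y.1 ∧ readWord ρ = w ∧
        ∀ c, opsData T (x c) n (opsOf c ρ) = y.2 c} := ⟨ρ₁, h3, h5, fun _ => rfl⟩
  rw [h2] at hmem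
  obtain ⟨ρ', h7, h8, h9⟩ := hmem
  refine ⟨by rw [← hh, 𝒜.h_append, 𝒜.h_append, h1], ρ' ++ ρ₂, isPath_append.2 ⟨r, h7, h4⟩,
    by rw [readWord_append, h8, h6], fun c => ?_⟩
  rw [opsOf_append]
  refine GoodOps.congr_left (h9 c).symm ?_
  rw [← opsOf_append]
  exact hg c

end Paths

/-! ### Segments of infinite sequences -/

/-- The finite sequence `f i, …, f (j - 1)`. -/
def seg {X : Type*} (f : ℕ → X) (i j : ℕ) : List X :=
  block (fun k => [f k]) i j

section Seg

variable {X : Type*}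

theorem seg_append (f : ℕ → X) {i j k : ℕ} (hij : i ≤ j) (hjk : j ≤ k) :
    seg f i j ++ seg f j k = seg f i k :=
  block_append _ hij hjk

theorem seg_self (f : ℕ → X) (i : ℕ) : seg f i i = [] :=
  block_self _ i

theorem seg_succ (f : ℕ → X) {i j : ℕ} (hij : i ≤ j) : seg f i (j + 1) = seg f i j ++ [f j] :=
  block_succ _ hij

theorem seg_zero (f : ℕ → X) (k : ℕ) : seg f 0 k = (List.range k).map f := by
  induction k with
  | zero => rw [seg_self]; rfl
  | succ k ih => rw [seg_succ f k.zero_le, ih, List.range_succ, List.map_append]; rfl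

theorem length_seg_zero (f : ℕ → X) (k : ℕ) : (seg f 0 k).length = k := by
  simp [seg_zero]

theorem opsOf_seg {A Q Γ : Type*} (c : Γ) (ρ : ℕ → Transition A Q Γ) {i j : ℕ} (hij : i ≤ j) :
    opsOf c (seg ρ i j) = seg (fun k => (ρ k).op c) i j := by
  induction j, hij using Nat.le_induction with
  | base => simp [seg_self, opsOf]
  | succ j hj ih => rw [seg_succ _ hj, seg_succ _ hj, opsOf_append, ih]; rfl

theorem readWord_seg {A Q Γ : Type*} (ρ : ℕ → Transition A Q Γ) {i j : ℕ} (hij : i ≤ j) :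
    readWord (seg ρ i j) = block (fun k => (ρ k).label.toList) i j := by
  induction j, hij using Nat.le_induction with
  | base => simp [seg_self, block_self, readWord]
  | succ j hj ih =>
    rw [seg_succ _ hj, block_succ _ hj, readWord_append, ih]
    cases h : (ρ j).label <;> simp [readWord, h]

theorem valueBefore_eq {A Q Γ : Type*} (c : Γ) (ρ : ℕ → Transition A Q Γ) (k : ℕ) :
    valueBefore c ρ k = opsValue 0 (seg (fun k => (ρ k).op c) 0 k) := by
  rw [valueBefore, ← seg_zero, counterValue_eq, opsOf_seg c ρ k.zero_le]

theorem isPath_seg {A Q Γ : Type*} {δ : Set (Transition A Q Γ)} {ρ : ℕ → Transition A Q Γ}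
    (hδ : ∀ k, ρ k ∈ δ) (hs : ∀ k, (ρ (k + 1)).src = (ρ k).tgt) {i j : ℕ} (hij : i ≤ j) :
    IsPath δ (ρ i).src (seg ρ i j) (ρ j).src := by
  induction j, hij using Nat.le_induction with
  | base => simp [seg_self, IsPath]
  | succ j hj ih =>
    rw [seg_succ _ hj, isPath_append]
    exact ⟨_, ih, hδ j, rfl, (hs j).symm⟩

theorem IsDecomposition.append_eq {A : Type*} {W W' : ℕ → List A} {u : ℕ → A}
    (hW : IsDecomposition W u) (hW' : IsDecomposition W' u) {i j : ℕ}
    (h : (block W 0 i).length = (block W' 0 j).length) : block W 0 i = block W' 0 j := by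
  rw [hW.1, hW'.1, h]

/-- An infinite run can be cut along a decomposition of the word that it reads. -/
theorem exists_cuts {A Q Γ : Type*} {ρ : ℕ → Transition A Q Γ} {u : ℕ → A}
    (hρ : IsDecomposition (fun k => (ρ k).label.toList) u) {W : ℕ → List A}
    (hW : IsDecomposition W u) :
    ∃ κ : ℕ → ℕ, Monotone κ ∧ Tendsto κ atTop atTop ∧ (∀ i, readWord (seg ρ 0 (κ i)) =
      block W 0 i) ∧ ∀ i j, i ≤ j → readWord (seg ρ (κ i) (κ j)) = block W i j := by
  classical
  set L : ℕ → List A := fun k => (ρ k).label.toList with hL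
  have hex : ∀ i, ∃ k, (block W 0 i).length ≤ (block L 0 k).length := fun i => hρ.2 _
  have hlen : ∀ {i j}, i ≤ j → (block W 0 i).length ≤ (block W 0 j).length := fun {i j} hij => by
    rw [← block_append W i.zero_le hij]; simp
  -- A transition reads at most one letter, so no length is skipped and the first time the required
  -- length is reached, it is met exactly.
  have hstep : ∀ k, (block L 0 (k + 1)).length ≤ (block L 0 k).length + 1 := fun k => by
    rw [block_succ L k.zero_le]
    cases h : (ρ k).label <;> simp [hL, h]
  have hκ : ∀ i, (block W 0 i).length = (block L 0 (Nat.find (hex i))).length := fun i => by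
    refine le_antisymm (Nat.find_spec (hex i)) ?_
    rcases hf : Nat.find (hex i) with _ | k
    · simp [block_self]
    · have := Nat.find_min (hex i) (m := k) (by omega)
      have := hstep k
      omega
  have hmono : Monotone fun i => Nat.find (hex i) := fun i j hij =>
    Nat.find_mono fun k hk => (hlen hij).trans hk
  have h0 : ∀ i, readWord (seg ρ 0 (Nat.find (hex i))) = block W 0 i := fun i => by
    rw [readWord_seg ρ (Nat.zero_le _)]
    exact hρ.append_eq hW (hκ i).symm
  have hle : ∀ k, (block L 0 k).length ≤ k := fun k => by
    induction k with
    | zero => simp [block_self]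
    | succ k ih => exact (hstep k).trans (Nat.succ_le_succ ih)
  refine ⟨fun i => Nat.find (hex i), hmono, ?_, h0, fun i j hij => ?_⟩
  · refine tendsto_atTop_atTop_of_monotone hmono fun m => ?_
    obtain ⟨n, hn⟩ := hW.2 m
    exact ⟨n, hn.trans ((hκ n).le.trans (hle _))⟩
  · have h1 := h0 j
    rw [← seg_append ρ (Nat.zero_le _) (hmono hij), readWord_append, h0 i,
      ← block_append W i.zero_le hij] at h1
    exact List.append_cancel_left h1

end Seg

/-! ### From accepting infinite runs to loops -/

/-- The masks that are used in the mode `T`. -/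
def Mode.AllowsMask : Mode → Bool → Prop
  | .B, x => x = false
  | .S, _ => True

section Loops

variable {o : ℕ → CounterOp}

theorem eventually_any_reset (h : ∃ᶠ k in atTop, o k = .reset) (i : ℕ) :
    ∀ᶠ j in atTop, (seg o i j).any CounterOp.isReset = true := by
  obtain ⟨k, hk, hr⟩ := frequently_atTop.1 h i
  filter_upwards [eventually_ge_atTop (k + 1)] with j hj
  rw [← seg_append o (show i ≤ k + 1 by omega) hj, seg_succ o hk]
  simp [hr, CounterOp.isReset]

/-- Starting a segment from `0` instead of the true carried value can only lower the values. -/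
theorem goodOps_seg_of_bounded {n i j : ℕ} (hb : ∀ k, opsValue 0 (seg o 0 k) ≤ n) (hij : i ≤ j)
    (hr : (seg o i j).any CounterOp.isReset = true) : GoodOps .B false n (seg o i j) := by
  have hle : ∀ j, i ≤ j → opsValue 0 (seg o i j) ≤ n := fun j hij => by
    refine le_trans (opsValue_mono (Nat.zero_le (opsValue 0 (seg o 0 i))) _) ?_
    rw [← opsValue_append, seg_append o i.zero_le hij]
    exact hb j
  refine ⟨hr, ?_⟩
  rw [Bool.not_false, maskOps_true, allResets_append, allResets_singleton]
  refine ⟨?_, fun _ => hle j hij⟩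
  clear hr
  induction j, hij using Nat.le_induction with
  | base => simp [seg_self, AllResets]
  | succ j hj ih =>
    rw [seg_succ o hj, allResets_append, allResets_singleton]
    exact ⟨ih, fun _ => hle j hj⟩

theorem allResets_maskOps_seg {n i j : ℕ} {x : Bool} (hij : i ≤ j)
    (h : ∀ k, i ≤ k → o k = .reset → (x = false ∨ (seg o i k).any CounterOp.isReset = true) →
      n < opsValue 0 (maskOps (!x) (seg o i k))) :
    AllResets (Mode.S.Admits n) 0 (maskOps (!x) (seg o i j)) := by
  induction j, hij using Nat.le_induction with
  | base => simp [seg_self, maskOps, AllResets]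
  | succ j hj ih =>
    rw [seg_succ o hj, maskOps_append, allResets_append]
    refine ⟨ih, ?_⟩
    rw [maskOps, maskOps, allResets_singleton]
    intro hr
    cases hb : (!x || (seg o i j).any CounterOp.isReset) with
    | false => simp [hb, CounterOp.isReset] at hr
    | true =>
      rw [hb, cond_true, CounterOp.isReset_iff] at hr
      exact h j hj hr (by simpa using hb)

/-- The mask records whether the counter values at the cuts tend to infinity along the ultrafilter.
If they do, the end of a block has a large value and the first reset may be left unchecked;
otherwise the carried value is bounded and every large value at a reset is produced mostly inside
the block. -/
theorem exists_goodOps_of_tendsto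
    (ht : Tendsto (fun k => opsValue 0 (seg o 0 k)) (atTop ⊓ 𝓟 {k | o k = .reset}) atTop)
    (hr : ∃ᶠ k in atTop, o k = .reset) {κ : ℕ → ℕ} (hκ : Monotone κ)
    (hκt : Tendsto κ atTop atTop) :
    ∃ x, ∀ n, ∀ᶠ i in (hyperfilter ℕ : Filter ℕ), ∀ᶠ j in (hyperfilter ℕ : Filter ℕ),
      GoodOps .S x n (seg o (κ i) (κ j)) := by
  have hV : ∀ N, ∃ k₀, ∀ k, k₀ ≤ k → o k = .reset → N < opsValue 0 (seg o 0 k) := fun N => by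
    have h1 := ht.eventually (eventually_gt_atTop N)
    rw [eventually_inf_principal, eventually_atTop] at h1
    exact h1
  have hU : (hyperfilter ℕ : Filter ℕ) ≤ atTop := Nat.hyperfilter_le_atTop
  have hres : ∀ i, ∀ᶠ j in (hyperfilter ℕ : Filter ℕ), i ≤ j ∧
      (seg o (κ i) (κ j)).any CounterOp.isReset = true := fun i =>
    ((eventually_ge_atTop i).filter_mono hU).and
      ((hκt.eventually (eventually_any_reset hr (κ i))).filter_mono hU)
  have hbig : ∀ k₀, ∀ᶠ i in (hyperfilter ℕ : Filter ℕ), k₀ ≤ κ i := fun k₀ =>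
    (hκt.eventually (eventually_ge_atTop k₀)).filter_mono hU
  by_cases hx : ∀ N, ∀ᶠ i in (hyperfilter ℕ : Filter ℕ), N < opsValue 0 (seg o 0 (κ i))
  · refine ⟨true, fun n => ?_⟩
    obtain ⟨k₀, hk₀⟩ := hV n
    have hval : ∀ i k, i ≤ k → (seg o i k).any CounterOp.isReset = true →
        opsValue 0 (maskOps false (seg o i k)) = opsValue 0 (seg o 0 k) := fun i k hik h => by
      rw [opsValue_maskOps h, ← seg_append o i.zero_le hik, opsValue_append]
      exact opsValue_eq_of_reset h _ _
    filter_upwards [hbig k₀] with i hi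
    filter_upwards [hres i, hx n] with j hj hjn
    refine ⟨hj.2, (allResets_append _ _ _ _).2 ⟨?_, ?_⟩⟩
    · refine allResets_maskOps_seg (hκ hj.1) fun k hk hok hres => ?_
      have hres' : (seg o (κ i) k).any CounterOp.isReset = true := by simpa using hres
      rw [Bool.not_true, hval _ _ hk hres']
      exact hk₀ k (hi.trans hk) hok
    · rw [allResets_singleton, Bool.not_true, hval _ _ (hκ hj.1) hj.2]
      exact fun _ => hjn
  · refine ⟨false, fun n => ?_⟩
    push Not at hx
    obtain ⟨N, hN⟩ := hx
    -- At most `N` is carried over the cut, so a reset value above `N + n` leaves more than `n` for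
    -- the block alone.
    obtain ⟨k₀, hk₀⟩ := hV (N + n)
    filter_upwards [hbig k₀, hN] with i hi hiN
    filter_upwards [hres i] with j hj
    refine ⟨hj.2, (allResets_append _ _ _ _).2 ⟨?_, ?_⟩⟩
    · refine allResets_maskOps_seg (hκ hj.1) fun k hk hok _ => ?_
      rw [Bool.not_false, maskOps_true]
      have h1 := hk₀ k (hi.trans hk) hok
      rw [← seg_append o (κ i).zero_le hk, opsValue_append] at h1
      have h2 := opsValue_le_add (opsValue 0 (seg o 0 (κ i))) (seg o (κ i) k)
      omega
    · simp [allResets_singleton, Mode.finalOp, CounterOp.isReset]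

end Loops

section Automaton

variable {A Q Γ : Type*}

/-- The words with value `e` over which there is a loop with the threshold `n` at a state that can
be reached from an initial state by `s`. -/
def CounterAutomaton.levelLang (𝒜 : CounterAutomaton A Q Γ) (T : Mode) (s e : TransMonoid Q)
    (n : ℕ) : Set (List A) :=
  {w | ∃ (q : Q) (x : Γ → Bool), (∃ p ∈ 𝒜.init, (p, q) ∈ s) ∧ (∀ c, T.AllowsMask (x c)) ∧
    w ∈ 𝒜.loopLang T e q x n}

/-- The language of profinite words for decompositions of type `(s, e)`. -/
def CounterAutomaton.typeLang (𝒜 : CounterAutomaton A Q Γ) (s e : TransMonoid Q) :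
    Mode → Set (ProWord A)
  | .B => ⋃ n : ℕ, profClosure (𝒜.levelLang .B s e n)
  | .S => ⋂ n : ℕ, profClosure (𝒜.levelLang .S s e n)

theorem CounterAutomaton.levelLang_antitone (𝒜 : CounterAutomaton A Q Γ) (s e : TransMonoid Q) :
    Antitone (𝒜.levelLang .S s e) := by
  rintro n n' h w ⟨q, x, h1, h2, h3, ρ, h4, h5, h6⟩
  exact ⟨q, x, h1, h2, h3, ρ, h4, h5, fun c => (h6 c).antitone h⟩

theorem exists_goodOps_of_omegaCondition [Finite Γ] {T : Mode} {ρ : ℕ → Transition A Q Γ}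
    (hr : ∀ c : Γ, ∃ᶠ k in atTop, (ρ k).op c = .reset) (hT : OmegaCondition T ρ) {κ : ℕ → ℕ}
    (hκ : Monotone κ) (hκt : Tendsto κ atTop atTop) :
    ∃ (x : Γ → Bool) (n₀ : ℕ), (∀ c, T.AllowsMask (x c)) ∧ ∀ n ≥ n₀,
      ∀ᶠ i in (hyperfilter ℕ : Filter ℕ), ∀ᶠ j in (hyperfilter ℕ : Filter ℕ),
        ∀ c, GoodOps T (x c) n (opsOf c (seg ρ (κ i) (κ j))) := by
  have hU : (hyperfilter ℕ : Filter ℕ) ≤ atTop := Nat.hyperfilter_le_atTop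
  cases T with
  | B =>
    obtain ⟨b, hb⟩ := hT
    refine ⟨fun _ => false, b, fun _ => rfl, fun n hn => Eventually.of_forall fun i => ?_⟩
    rw [eventually_all]
    intro c
    filter_upwards [(eventually_ge_atTop i).filter_mono hU,
      (hκt.eventually (eventually_any_reset (hr c) (κ i))).filter_mono hU] with j hij hj
    rw [opsOf_seg c ρ (hκ hij)]
    exact goodOps_seg_of_bounded (fun k => by rw [← valueBefore_eq]; exact (hb c k).trans hn)
      (hκ hij) hj
  | S =>
    have h : ∀ c : Γ, ∃ x, ∀ n, ∀ᶠ i in (hyperfilter ℕ : Filter ℕ),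
        ∀ᶠ j in (hyperfilter ℕ : Filter ℕ),
          GoodOps .S x n (seg (fun k => (ρ k).op c) (κ i) (κ j)) := fun c =>
      exists_goodOps_of_tendsto (by simpa only [← valueBefore_eq] using hT c) (hr c) hκ hκt
    choose x hx using h
    refine ⟨x, 0, fun _ => trivial, fun n _ => ?_⟩
    have h1 := eventually_all.2 fun c => hx c n
    filter_upwards [h1] with i hi
    filter_upwards [(eventually_ge_atTop i).filter_mono hU, eventually_all.2 hi] with j hij hj c
    rw [opsOf_seg c ρ (hκ hij)]
    exact hj c

theorem exists_grouping_of_mem_omegaLang [Finite A] [Finite Q] [Finite Γ]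
    (𝒜 : CounterAutomaton A Q Γ) {T : Mode} {s e : TransMonoid Q} {u : ℕ → A} {W : ℕ → List A}
    (hW : IsDecomposition W u) (ht : HasType 𝒜.h W s e) (hu : u ∈ 𝒜.omegaLang T) :
    ∃ Z, IsGrouping W Z ∧ ∃ z ∈ 𝒜.typeLang s e T, StronglyConvergesTo Z z := by
  obtain ⟨ρ, ⟨hinit, hδ, hsrc, hdec⟩, hr, hT⟩ := hu
  obtain ⟨κ, hκ, hκt, hw0, hw⟩ := exists_cuts hdec hW
  obtain ⟨x, n₀, hx, hgood⟩ := exists_goodOps_of_omegaCondition hr hT hκ hκt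
  have hU : (hyperfilter ℕ : Filter ℕ) ≤ atTop := Nat.hyperfilter_le_atTop
  -- There are finitely many states, so the ultrafilter selects one of them at the cuts.
  obtain ⟨q, hq⟩ : ∃ q, ∀ᶠ i in (hyperfilter ℕ : Filter ℕ), (ρ (κ i)).src = q := by
    by_contra! h
    obtain ⟨i, hi⟩ := (eventually_all.2 fun q => h q).exists
    exact hi _ rfl
  have hqs : ∃ p ∈ 𝒜.init, (p, q) ∈ s := by
    obtain ⟨i, hi, hi0⟩ := (hq.and ((eventually_gt_atTop 0).filter_mono hU)).exists
    refine ⟨_, hinit, ?_⟩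
    rw [← h_block_eq_left 𝒜 ht hi0, ← hi]
    exact ⟨_, isPath_seg hδ hsrc (Nat.zero_le _), hw0 i⟩
  have hlevel : ∀ n, ∀ᶠ i in (hyperfilter ℕ : Filter ℕ), ∀ᶠ j in (hyperfilter ℕ : Filter ℕ),
      block W i j ∈ 𝒜.levelLang T s e (n₀ + n) := fun n => by
    filter_upwards [hq, hgood (n₀ + n) (Nat.le_add_right _ _),
      (eventually_gt_atTop 0).filter_mono hU] with i hi hgi hi0
    filter_upwards [hq, hgi, (eventually_gt_atTop i).filter_mono hU] with j hj hgj hij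
    refine ⟨q, x, hqs, hx, h_block_eq_right 𝒜 ht hi0 hij, seg ρ (κ i) (κ j), ?_, hw i j hij.le,
      hgj⟩
    have := isPath_seg hδ hsrc (hκ hij.le)
    rwa [hi, hj] at this
  obtain ⟨Z, hZ, z, hz, hZl⟩ := exists_grouping_stronglyConvergesTo W _ hlevel
  have hmem : ∀ n, z ∈ profClosure (𝒜.levelLang T s e (n₀ + n)) := fun n =>
    hz.convergesTo.mem_profClosure <| (hZl n).mono fun m ⟨i, j, _, _, h, hm⟩ => by rwa [hm]
  refine ⟨Z, hZ, z, ?_, hz⟩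
  cases T with
  | B => exact Set.mem_iUnion.2 ⟨_, hmem 0⟩
  | S =>
    exact Set.mem_iInter.2 fun n => closure_mono
      (Set.image_mono (𝒜.levelLang_antitone s e (Nat.le_add_left n n₀))) (hmem n)

end Automaton

/-! ### Infinite concatenations -/

section Concatenation

variable {X : Type*}

theorem seg_take (f : ℕ → X) {k n : ℕ} (hkn : k ≤ n) : (seg f 0 n).take k = seg f 0 k := by
  rw [← seg_append f k.zero_le hkn]
  exact List.take_left' (length_seg_zero f k)

theorem length_block_mono (R : ℕ → List X) : Monotone fun n => (block R 0 n).length :=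
  fun i j hij => by
    simp [← block_append R i.zero_le hij]

/-- The finite concatenations are prefixes of each other, so letter `k` can be read off any of them
that is longer than `k`. -/
theorem exists_isDecomposition (R : ℕ → List X) (h : ∀ m, ∃ n, m ≤ (block R 0 n).length) :
    ∃ ρ, IsDecomposition R ρ := by
  choose n hn using fun k => h (k + 1)
  refine ⟨fun k => (block R 0 (n k))[k]'(hn k), fun m => ?_, h⟩
  refine List.ext_getElem (by simp) fun k h1 h2 => ?_
  simp only [List.getElem_map, List.getElem_range]
  rcases le_total m (n k) with hle | hle
  · simp only [← block_append R m.zero_le hle]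
    rw [List.getElem_append_left h1]
  · simp only [← block_append R (n k).zero_le hle]
    rw [List.getElem_append_left (hn k)]

theorem IsDecomposition.seg_eq {R : ℕ → List X} {ρ : ℕ → X} (h : IsDecomposition R ρ) (n : ℕ) :
    seg ρ 0 (block R 0 n).length = block R 0 n := by
  rw [seg_zero, ← h.1]

theorem IsDecomposition.seg_add_eq {R : ℕ → List X} {ρ : ℕ → X} (h : IsDecomposition R ρ)
    {m l : ℕ} (hl : l ≤ (R m).length) :
    seg ρ 0 ((block R 0 m).length + l) = block R 0 m ++ (R m).take l := by
  have h1 := h.seg_eq (m + 1)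
  rw [block_succ R m.zero_le, List.length_append] at h1
  rw [← seg_take ρ (Nat.add_le_add_left hl _), h1, List.take_length_add_append]

theorem IsDecomposition.exists_position {R : ℕ → List X} {ρ : ℕ → X} (h : IsDecomposition R ρ)
    (k : ℕ) : ∃ m l, k = (block R 0 m).length + l ∧ l < (R m).length := by
  classical
  have hex : ∃ n, k < (block R 0 n).length := h.2 (k + 1)
  rcases hf : Nat.find hex with _ | m
  · have := Nat.find_spec hex
    rw [hf, block_self] at this
    simp at this
  · have h1 := Nat.find_spec hex
    have h2 := Nat.find_min hex (m := m) (by omega)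
    rw [hf, block_succ R m.zero_le, List.length_append] at h1
    exact ⟨m, k - (block R 0 m).length, by omega, by omega⟩

theorem IsGrouping.isDecomposition {W Z : ℕ → List X} {u : ℕ → X} (hZ : IsGrouping W Z)
    (hW : IsDecomposition W u) : IsDecomposition Z u := by
  obtain ⟨i, hi0, hi, hZ⟩ := hZ
  have h : ∀ n, block Z 0 n = block W 0 (i n) := fun n => by
    rw [block_block hi hZ n.zero_le, hi0]
  refine ⟨fun n => by rw [h]; exact hW.1 _, fun m => ?_⟩
  obtain ⟨n, hn⟩ := hW.2 m
  refine ⟨n, hn.trans ?_⟩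
  rw [h]
  exact length_block_mono W (hi.id_le n)

theorem eq_map_range_of_prefix {l : List X} {u : ℕ → X} {k : ℕ}
    (h : l <+: (List.range k).map u) : l = (List.range l.length).map u := by
  rw [← seg_zero] at h ⊢
  have hk : l.length ≤ k := by simpa [length_seg_zero] using h.length_le
  rw [← seg_take u hk]
  exact List.prefix_iff_eq_take.1 h

theorem IsPath.of_seg {A Q Γ : Type*} {δ : Set (Transition A Q Γ)} {ρ : ℕ → Transition A Q Γ}
    {p q : Q} {n : ℕ} (h : IsPath δ p (seg ρ 0 n) q) :
    (∀ k < n, ρ k ∈ δ) ∧ (0 < n → (ρ 0).src = p) ∧ ∀ k, k + 1 < n → (ρ (k + 1)).src = (ρ k).tgt := by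
  have key : ∀ k < n, ∃ r r', IsPath δ p (seg ρ 0 k) r ∧ ρ k ∈ δ ∧ (ρ k).src = r ∧
      IsPath δ (ρ k).tgt (seg ρ (k + 1) n) r' := fun k hk => by
    rw [← seg_append ρ (k + 1).zero_le hk, seg_succ ρ k.zero_le, isPath_append] at h
    obtain ⟨r', h1, h2⟩ := h
    obtain ⟨r, h3, h4, h5, h6⟩ := isPath_append.1 h1
    have h6' : (ρ k).tgt = r' := h6
    exact ⟨r, q, h3, h4, h5, h6' ▸ h2⟩
  refine ⟨fun k hk => ?_, fun hn => ?_, fun k hk => ?_⟩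
  · obtain ⟨_, _, _, h, _⟩ := key k hk
    exact h
  · obtain ⟨r, _, h1, _, h2, _⟩ := key 0 hn
    rw [seg_self] at h1
    exact h2.trans (show p = r from h1).symm
  · obtain ⟨_, _, _, _, _, h⟩ := key k (by omega)
    rw [← seg_append ρ (k + 1).le_succ hk, seg_succ ρ le_rfl, seg_self] at h
    exact h.2.1

theorem opsValue_seg {A Q Γ : Type*} {ρ : ℕ → Transition A Q Γ}
    {R : ℕ → List (Transition A Q Γ)} (h : IsDecomposition R ρ) (c : Γ) {m l : ℕ}
    (hl : l ≤ (R m).length) : valueBefore c ρ ((block R 0 m).length + l) =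
      opsValue (opsValue 0 (opsOf c (block R 0 m))) ((opsOf c (R m)).take l) := by
  rw [valueBefore_eq, ← opsOf_seg c ρ (Nat.zero_le _), h.seg_add_eq hl, opsOf_append,
    opsValue_append]
  simp [opsOf]

theorem IsDecomposition.apply_eq {R : ℕ → List X} {ρ : ℕ → X} (h : IsDecomposition R ρ) {m l : ℕ}
    (hl : l < (R m).length) : ρ ((block R 0 m).length + l) = (R m)[l] := by
  have h1 := h.seg_add_eq (Nat.succ_le_of_lt hl)
  rw [Nat.add_succ, Nat.succ_eq_add_one, seg_succ ρ (Nat.zero_le _), h.seg_add_eq hl.le,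
    List.take_succ_eq_append_getElem hl, ← List.append_assoc] at h1
  simpa using List.append_cancel_left h1

end Concatenation

/-! ### From loops to accepting infinite runs -/

section Automaton

variable {A Q Γ : Type*}

/-- The concatenated run is infinite because it has at least as many transitions as letters read,
even when ε-transitions occur. -/
theorem isOmegaRun_of_paths (𝒜 : CounterAutomaton A Q Γ) {u : ℕ → A} {Y : ℕ → List A}
    (hY : IsDecomposition Y u) {R : ℕ → List (Transition A Q Γ)} {p q : Q} (hp : p ∈ 𝒜.init)
    (h0 : IsPath 𝒜.trans p (R 0) q) (hR : ∀ m, IsPath 𝒜.trans q (R (m + 1)) q)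
    (hw : ∀ m, readWord (R m) = Y m) : ∃ ρ, IsDecomposition R ρ ∧ 𝒜.IsOmegaRun ρ u := by
  have hread : ∀ n, readWord (block R 0 n) = block Y 0 n := fun n => by
    induction n with
    | zero => simp [block_self, readWord]
    | succ n ih =>
      rw [block_succ _ n.zero_le, block_succ _ n.zero_le, readWord_append, ih, hw]
  have hlen : ∀ m, ∃ n, m ≤ (block R 0 n).length := fun m => by
    obtain ⟨n, hn⟩ := hY.2 m
    refine ⟨n, hn.trans ?_⟩
    rw [← hread]
    exact List.length_filterMap_le _ _
  obtain ⟨ρ, hρ⟩ := exists_isDecomposition R hlen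
  have hpath : ∀ n, IsPath 𝒜.trans p (block R 0 (n + 1)) q := fun n => by
    induction n with
    | zero => rw [zero_add, block_succ_self]; exact h0
    | succ n ih =>
      rw [block_succ _ (Nat.zero_le _)]
      exact isPath_append.2 ⟨q, ih, hR n⟩
  have hseg : ∀ k, ∃ n, k < n ∧ IsPath 𝒜.trans p (seg ρ 0 n) q := fun k => by
    obtain ⟨n, hn⟩ := hlen (k + 1)
    refine ⟨(block R 0 (n + 1)).length, hn.trans (length_block_mono R n.le_succ), ?_⟩
    rw [hρ.seg_eq]
    exact hpath n
  refine ⟨ρ, hρ, ?_, fun k => ?_, fun k => ?_, fun k => ?_, fun m => ?_⟩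
  · obtain ⟨n, hn, h⟩ := hseg 0
    rw [h.of_seg.2.1 hn]
    exact hp
  · obtain ⟨n, hn, h⟩ := hseg k
    exact h.of_seg.1 k hn
  · obtain ⟨n, hn, h⟩ := hseg (k + 1)
    exact h.of_seg.2.2 k hn
  · obtain ⟨n, hn⟩ := hlen k
    rw [← readWord_seg ρ k.zero_le]
    refine eq_map_range_of_prefix (k := (block Y 0 n).length) ?_
    rw [← hY.1 n, ← hread n, ← hρ.seg_eq n, ← seg_append ρ k.zero_le hn, readWord_append]
    exact List.prefix_append _ _
  · obtain ⟨n, hn⟩ := hY.2 m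
    refine ⟨(block R 0 n).length, ?_⟩
    rw [← readWord_seg ρ (Nat.zero_le _), hρ.seg_eq, hread]
    exact hn

variable {ρ : ℕ → Transition A Q Γ} {R : ℕ → List (Transition A Q Γ)}

theorem frequently_reset (hρ : IsDecomposition R ρ) {c : Γ}
    (h : ∀ m, (opsOf c (R (m + 1))).any CounterOp.isReset = true) :
    ∃ᶠ k in atTop, (ρ k).op c = .reset := by
  rw [frequently_atTop]
  intro k
  obtain ⟨n, hn⟩ := hρ.2 k
  obtain ⟨_, ha, hr⟩ := List.any_eq_true.1 (h n)
  obtain ⟨t, ht, rfl⟩ := List.mem_map.1 ha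
  obtain ⟨l, hl, rfl⟩ := List.getElem_of_mem ht
  refine ⟨(block R 0 (n + 1)).length + l, ?_, ?_⟩
  · exact hn.trans ((length_block_mono R n.le_succ).trans (Nat.le_add_right _ _))
  · rw [hρ.apply_eq hl]
    exact (CounterOp.isReset_iff _).1 hr

theorem opsValue_block_succ {c : Γ} {m : ℕ}
    (h : (opsOf c (R m)).any CounterOp.isReset = true) :
    opsValue 0 (opsOf c (block R 0 (m + 1))) = opsValue 0 (opsOf c (R m)) := by
  rw [block_succ _ m.zero_le, opsOf_append, opsValue_append]
  exact opsValue_eq_of_reset h _ _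

theorem omegaCondition_B_of_goodOps (hρ : IsDecomposition R ρ) {n : ℕ}
    (h : ∀ m c, GoodOps .B false n (opsOf c (R (m + 1)))) : OmegaCondition .B ρ := by
  have hle : ∀ m c l, opsValue 0 ((opsOf c (R (m + 1))).take l) ≤ n := fun m c l => by
    have h1 := (h m c).2
    rw [Bool.not_false, maskOps_true] at h1
    exact opsValue_take_le h1 l
  have hle' : ∀ m c, opsValue 0 (opsOf c (R (m + 1))) ≤ n := fun m c => by
    simpa only [List.take_length] using hle m c (opsOf c (R (m + 1))).length
  have hstart : ∀ c l, opsValue 0 ((opsOf c (R 0)).take l) ≤ (R 0).length := fun c l => by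
    refine (opsValue_le_length _ _).trans ?_
    simp [opsOf]
  -- The value carried into a loop is at most `(R 0).length` (from the initial path) or `n` (from a
  -- preceding loop, which contains a reset); the current loop adds at most `n`.
  refine ⟨(R 0).length + n + n, fun c k => ?_⟩
  obtain ⟨m, l, rfl, hl⟩ := hρ.exists_position k
  rw [opsValue_seg hρ c hl.le]
  rcases m with _ | m
  · rw [block_self]
    exact (hstart c l).trans (by omega)
  · refine (opsValue_le_add _ _).trans (Nat.add_le_add ?_ (hle m c l))
    rcases m with _ | m
    · rw [block_succ_self]
      have := hstart c (opsOf c (R 0)).length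
      rw [List.take_length] at this
      exact this.trans (Nat.le_add_right _ _)
    · rw [opsValue_block_succ (h m c).1]
      exact (hle' m c).trans (Nat.le_add_left _ _)

theorem omegaCondition_S_of_goodOps (hρ : IsDecomposition R ρ) {N : ℕ → ℕ}
    (hN : Tendsto N atTop atTop) {x : Γ → Bool}
    (h : ∀ m c, GoodOps .S (x c) (N m) (opsOf c (R (m + 1)))) : OmegaCondition .S ρ := by
  intro c
  rw [tendsto_atTop]
  intro b
  rw [eventually_inf_principal]
  obtain ⟨M, hM⟩ := eventually_atTop.1 (hN.eventually (eventually_ge_atTop b))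
  -- Beyond block `M + 2` both the current loop and the one before it have thresholds at least `b`;
  -- the masked case needs the latter.
  filter_upwards [eventually_ge_atTop (block R 0 (M + 2)).length] with k hk hr
  obtain ⟨m, l, rfl, hl⟩ := hρ.exists_position k
  have hm : M + 2 ≤ m := by
    by_contra! hlt
    have h1 := length_block_mono R (show m + 1 ≤ M + 2 by omega)
    simp only [block_succ R m.zero_le, List.length_append] at h1
    omega
  obtain ⟨m, rfl⟩ : ∃ m', m = m' + 2 := ⟨m - 2, by omega⟩
  have hMm : b ≤ N m ∧ b ≤ N (m + 1) := ⟨hM _ (by omega), hM _ (by omega)⟩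
  rw [hρ.apply_eq hl] at hr
  rw [opsValue_seg hρ c hl.le, opsValue_block_succ (h m c).1]
  set o := opsOf c (R (m + 2)) with ho
  have hol : o = o.take l ++ .reset :: o.drop (l + 1) := by
    have hl' : l < o.length := by simpa [ho, opsOf] using hl
    have : o[l] = .reset := by simpa [ho, opsOf] using hr
    rw [← this, List.cons_getElem_drop_succ, List.take_append_drop]
  have h1 := (h (m + 1) c).2
  rw [← ho, hol, maskOps_append, List.append_assoc, allResets_append] at h1
  have h2 := h1.2
  -- Either the mask leaves this reset visible and the current loop itself guarantees a large value,
  -- or it is the first reset of a masked counter. Then the counter has not dropped since the start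
  -- of the loop, where it was large by the final check of the preceding loop.
  by_cases ha : (!(x c) || (o.take l).any CounterOp.isReset) = true
  · rw [ha, maskOps] at h2
    have h3 : N (m + 1) < opsValue 0 (maskOps (!(x c)) (o.take l)) := h2.1 rfl
    have h4 : opsValue 0 (maskOps (!(x c)) (o.take l)) = opsValue 0 (o.take l) := by
      cases hx : x c with
      | false => rw [Bool.not_false, maskOps_true]
      | true => exact opsValue_maskOps (by simpa [hx] using ha) _
    have h5 := opsValue_mono (Nat.zero_le (opsValue 0 (opsOf c (R (m + 1))))) (o.take l)
    omega
  · simp only [Bool.or_eq_true, Bool.not_eq_true', not_or, Bool.not_eq_false,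
      Bool.not_eq_true] at ha
    refine le_trans ?_ (le_opsValue_of_no_reset ha.2 _)
    have h3 := (h m c).2
    rw [allResets_append, ha.1, opsValue_maskOps (h m c).1] at h3
    have h4 : N m < _ := h3.2.1 rfl
    omega

/-! ### Extracting loops of one kind from a profinite limit -/

theorem mem_profClosure_iUnion {ι : Type*} [Finite ι] {K : ι → Set (List A)} {z : ProWord A}
    (h : z ∈ profClosure (⋃ i, K i)) : ∃ i, z ∈ profClosure (K i) := by
  rw [profClosure, Set.image_iUnion, closure_iUnion_of_finite] at h
  exact Set.mem_iUnion.1 h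

/-- Pigeonhole: if every `i` failed at some level, all would fail at the maximum of these finitely
many levels. -/
theorem exists_forall_of_antitone {ι : Type*} [Finite ι] {P : ℕ → ι → Prop}
    (hP : ∀ i m n, m ≤ n → P n i → P m i) (h : ∀ n, ∃ i, P n i) : ∃ i, ∀ n, P n i := by
  by_contra! hc
  choose n hn using hc
  obtain ⟨m, hm⟩ := (Set.finite_range n).bddAbove
  obtain ⟨i, hi⟩ := h m
  exact hn i (hP i _ _ (hm ⟨i, rfl⟩) hi)

theorem CounterAutomaton.loopLang_antitone (𝒜 : CounterAutomaton A Q Γ) (e : TransMonoid Q) (q : Q)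
    (x : Γ → Bool) {m n : ℕ} (h : m ≤ n) {w : List A}
    (hw : w ∈ 𝒜.loopLang .S e q x n) : w ∈ 𝒜.loopLang .S e q x m := by
  obtain ⟨hw, ρ, h4, h5, h6⟩ := hw
  exact ⟨hw, ρ, h4, h5, fun c => (h6 c).antitone h⟩

/-- A profinite word of `typeLang` is eventually approximated by loops of one kind. -/
theorem exists_eventually_mem_loopLang [Finite Q] [Finite Γ] (𝒜 : CounterAutomaton A Q Γ)
    {T : Mode} {s e : TransMonoid Q} {z : ProWord A} (hz : z ∈ 𝒜.typeLang s e T)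
    {Z : ℕ → List A} (hZ : ConvergesTo Z z) :
    ∃ (q : Q) (x : Γ → Bool) (N : ℕ → ℕ), (∃ p ∈ 𝒜.init, (p, q) ∈ s) ∧
      (∀ c, T.AllowsMask (x c)) ∧ (T = .B → ∃ n, N = fun _ => n) ∧
      (T = .S → Tendsto N atTop atTop) ∧ ∀ᶠ m in atTop, Z m ∈ 𝒜.loopLang T e q x (N m) := by
  classical
  have hlevel : ∀ n, z ∈ profClosure (𝒜.levelLang T s e n) →
      ∃ i : {i : Q × (Γ → Bool) // (∃ p ∈ 𝒜.init, (p, i.1) ∈ s) ∧ ∀ c, T.AllowsMask (i.2 c)},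
        z ∈ profClosure (𝒜.loopLang T e i.1.1 i.1.2 n : Set (List A)) := fun n hn => by
    -- Closure commutes with the union over the finitely many pairs of a state and a mask.
    refine mem_profClosure_iUnion (closure_mono (Set.image_mono ?_) hn)
    rintro w ⟨q, x, h1, h2, h3⟩
    exact Set.mem_iUnion.2 ⟨⟨(q, x), h1, h2⟩, h3⟩
  cases T with
  | B =>
    obtain ⟨n, hn⟩ := Set.mem_iUnion.1 hz
    obtain ⟨⟨⟨q, x⟩, h1, h2⟩, h3⟩ := hlevel n hn
    exact ⟨q, x, fun _ => n, h1, h2, fun _ => ⟨n, rfl⟩, nofun,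
      hZ.eventually_mem (𝒜.isRegular_loopLang _ e q x n) h3⟩
  | S =>
    obtain ⟨⟨⟨q, x⟩, h1, h2⟩, h3⟩ := exists_forall_of_antitone
      (fun i m n hmn h => closure_mono (Set.image_mono
        fun _ => 𝒜.loopLang_antitone e i.1.1 i.1.2 hmn) h)
      fun n => hlevel n (Set.mem_iInter.1 hz n)
    have hev : ∀ n, ∀ᶠ m in atTop, Z m ∈ 𝒜.loopLang .S e q x n := fun n =>
      hZ.eventually_mem (𝒜.isRegular_loopLang _ e q x n) (h3 n)
    -- The threshold for `Z m` is the largest one it meets, capped at `m` so that a maximum exists;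
    -- it tends to infinity since each fixed level is eventually met.
    refine ⟨q, x, fun m => Nat.findGreatest (fun n => Z m ∈ 𝒜.loopLang .S e q x n) m, h1, h2,
      nofun, fun _ => ?_, ?_⟩
    · refine tendsto_atTop.2 fun n => ?_
      filter_upwards [hev n, eventually_ge_atTop n] with m hm hnm
      exact Nat.le_findGreatest hnm hm
    · filter_upwards [hev 0] with m hm
      exact Nat.findGreatest_spec (P := fun n => Z m ∈ 𝒜.loopLang .S e q x n) m.zero_le hm

theorem mem_omegaLang_of_grouping [Finite Q] [Finite Γ] (𝒜 : CounterAutomaton A Q Γ) {T : Mode}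
    {s e : TransMonoid Q} {u : ℕ → A} {W Z : ℕ → List A} (hW : IsDecomposition W u)
    (ht : HasType 𝒜.h W s e) (hZ : IsGrouping W Z) {z : ProWord A} (hz : z ∈ 𝒜.typeLang s e T)
    (hc : ConvergesTo Z z) : u ∈ 𝒜.omegaLang T := by
  obtain ⟨q, x, N, ⟨p, hp, hpq⟩, hx, hB, hS, hev⟩ := exists_eventually_mem_loopLang 𝒜 hz hc
  obtain ⟨m₀, hm₀⟩ := eventually_atTop.1 hev
  -- The groups up to `Z m₀` are merged into a single one. It contains `W 0`, so its value is `s`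
  -- and it leads from an initial state to `q`; all later groups are loops.
  let i : ℕ → ℕ := fun n => Nat.casesOn n 0 fun n => m₀ + n + 1
  have hi : StrictMono i := strictMono_nat_of_lt_succ fun n => by
    cases n with
    | zero => exact Nat.succ_pos _
    | succ n => exact show m₀ + n + 1 < m₀ + (n + 1) + 1 by omega
  let Y : ℕ → List A := fun n => block Z (i n) (i (n + 1))
  have hY : IsDecomposition Y u :=
    IsGrouping.isDecomposition ⟨i, rfl, hi, fun _ => rfl⟩ (hZ.isDecomposition hW)
  have hY0 : 𝒜.h (Y 0) = s := by
    obtain ⟨j, hj0, hj, hZj⟩ := hZ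
    have : Y 0 = block W (j 0) (j (m₀ + 1)) := block_block hj hZj (Nat.zero_le _)
    rw [this, hj0]
    exact h_block_eq_left 𝒜 ht (lt_of_lt_of_le (Nat.succ_pos _) (hj.id_le _))
  have hYs : ∀ n, Y (n + 1) ∈ 𝒜.loopLang T e q x (N (m₀ + n + 1)) := fun n => by
    have : Y (n + 1) = Z (m₀ + n + 1) := block_succ_self Z _
    rw [this]
    exact hm₀ _ (by omega)
  rw [← hY0] at hpq
  obtain ⟨R₀, hR₀, hw₀⟩ := hpq
  choose _ R hR hw hg using hYs
  let R' : ℕ → List (Transition A Q Γ) := fun n => Nat.casesOn n R₀ R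
  obtain ⟨ρ, hρ, hrun⟩ := isOmegaRun_of_paths 𝒜 hY (R := R') hp hR₀ hR fun m => by
    cases m with
    | zero => exact hw₀
    | succ m => exact hw m
  refine ⟨ρ, hrun, fun c => frequently_reset hρ fun m => (hg m c).1, ?_⟩
  cases T with
  | B =>
    obtain ⟨n, rfl⟩ := hB rfl
    refine omegaCondition_B_of_goodOps hρ (n := n) fun m c => ?_
    have := hg m c
    rwa [show x c = false from hx c] at this
  | S =>
    exact omegaCondition_S_of_goodOps hρ (N := fun m => N (m₀ + m + 1)) ((hS rfl).comp
      (tendsto_atTop_mono (fun m => show m ≤ m₀ + m + 1 by omega) tendsto_id)) hg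

theorem tfae_mem_omegaLang [Finite A] [Finite Q] [Finite Γ] (𝒜 : CounterAutomaton A Q Γ)
    (T : Mode) {s e : TransMonoid Q} {u : ℕ → A} {W : ℕ → List A} (hW : IsDecomposition W u)
    (ht : HasType 𝒜.h W s e) :
    [u ∈ 𝒜.omegaLang T,
      ∃ Z, IsGrouping W Z ∧ ∃ z ∈ 𝒜.typeLang s e T, StronglyConvergesTo Z z,
      ∃ Z, IsGrouping W Z ∧ ∃ z ∈ 𝒜.typeLang s e T, ConvergesTo Z z].TFAE := by
  tfae_have 1 → 2 := exists_grouping_of_mem_omegaLang 𝒜 hW ht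
  tfae_have 2 → 3 := fun ⟨Z, hZ, z, hz, hc⟩ => ⟨Z, hZ, z, hz, hc.convergesTo⟩
  tfae_have 3 → 1 := fun ⟨Z, hZ, z, hz, hc⟩ => mem_omegaLang_of_grouping 𝒜 hW ht hZ hz hc
  tfae_finish

theorem CounterAutomaton.typeLang_subset (𝒜 : CounterAutomaton A Q Γ) (T : Mode)
    (s e : TransMonoid Q) : 𝒜.typeLang s e T ⊆ profClosure {w : List A | 𝒜.h w = e} := by
  have h : ∀ n, profClosure (𝒜.levelLang T s e n) ⊆ profClosure {w : List A | 𝒜.h w = e} :=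
    fun n => closure_mono (Set.image_mono fun w ⟨_, _, _, _, hw, _⟩ => hw)
  cases T with
  | B => exact Set.iUnion_subset h
  | S => exact (Set.iInter_subset _ 0).trans (h 0)

end Automaton

/-! ### Recognition by automata on finite words -/

section Values

variable {A Q Γ : Type*}

/-- The words that have an accepting run fulfilling the requirement for the threshold `n`. -/
def FinCounterAutomaton.acceptLang (ℬ : FinCounterAutomaton A Q Γ) (T : Mode) (n : ℕ) :
    Set (List A) :=
  {w | ∃ ρ, ℬ.IsAccepting ρ w ∧ ∀ c, AllResets (T.Admits n) 0 (opsOf c ρ)}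

theorem forall_mem_resetValues (P : ℕ∞ → Prop) (ρ : List (Transition A Q Γ)) :
    (∀ v ∈ resetValues ρ, P v) ↔ ∀ c, AllResets (fun n => P n) 0 (opsOf c ρ) := by
  simp only [allResets_iff]
  constructor
  · intro h c k hk
    obtain ⟨t, ht, hr⟩ : ∃ t, ρ[k]? = some t ∧ t.op c = .reset := by
      simpa [opsOf] using hk
    have := h _ ⟨c, k, t, ht, hr, rfl⟩
    rwa [counterValue_eq, opsOf, List.map_take] at this
  · rintro h _ ⟨c, k, t, ht, hr, rfl⟩
    rw [counterValue_eq, opsOf, List.map_take]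
    exact h c k (by simp [opsOf, ht, hr])

/-- Since `n` is finite, `≤ n` is `< n + 1`, and a strict bound on an infimum is witnessed by a
single run. Runs without resets have value `0` and satisfy the right side vacuously. -/
theorem FinCounterAutomaton.value_B_le_iff (ℬ : FinCounterAutomaton A Q Γ) (w : List A) (n : ℕ) :
    ℬ.value .B w ≤ n ↔ w ∈ ℬ.acceptLang .B n := by
  have h1 : ∀ v : ℕ∞, v < (n : ℕ∞) + 1 ↔ v ≤ n := fun v => ENat.lt_add_one_iff (ENat.natCast_ne_top n)
  rw [← h1, FinCounterAutomaton.value, sInf_lt_iff, Set.exists_mem_image]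
  refine exists_congr fun ρ => and_congr Iff.rfl ?_
  rw [h1, runValue, sSup_le_iff, forall_mem_resetValues]
  simp only [Nat.cast_le]
  rfl

/-- Dually, `n <` a supremum is witnessed by one run, and `n <` an infimum becomes `n + 1 ≤`. A run
without resets has value `⊤`, again in accordance with the vacuous condition. -/
theorem FinCounterAutomaton.lt_value_S_iff (ℬ : FinCounterAutomaton A Q Γ) (w : List A) (n : ℕ) :
    (n : ℕ∞) < ℬ.value .S w ↔ w ∈ ℬ.acceptLang .S n := by
  have h1 : ∀ v : ℕ∞, (n : ℕ∞) + 1 ≤ v ↔ (n : ℕ∞) < v :=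
    fun v => ENat.add_one_le_iff (ENat.natCast_ne_top n)
  rw [FinCounterAutomaton.value, lt_sSup_iff, Set.exists_mem_image]
  refine exists_congr fun ρ => and_congr Iff.rfl ?_
  rw [← h1, runValue, le_sInf_iff, forall_mem_resetValues]
  simp only [h1, Nat.cast_lt]
  rfl

theorem FinCounterAutomaton.profLang_eq {Q' Γ' : Type*} (ℬ : FinCounterAutomaton A Q' Γ')
    (𝒜 : CounterAutomaton A Q Γ) (T : Mode) (s e : TransMonoid Q)
    (h : ∀ n, ℬ.acceptLang T n = 𝒜.levelLang T s e n) : ℬ.profLang T = 𝒜.typeLang s e T := by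
  cases T with
  | B =>
    refine Set.iUnion_congr fun n => ?_
    rw [← h n]
    exact congrArg profClosure (Set.ext fun w => ℬ.value_B_le_iff w n)
  | S =>
    refine Set.iInter_congr fun n => ?_
    rw [← h n]
    exact congrArg profClosure (Set.ext fun w => ℬ.lt_value_S_iff w n)

end Values

/-! ### Computing the transition monoid on codes -/

/-- All pairs of numbers below `n`. -/
def pairs (n : ℕ) : List (ℕ × ℕ) :=
  (List.range n).flatMap fun i => (List.range n).map fun j => (i, j)

/-- The canonical list of the pairs of numbers below `n` that belong to `H`. -/
def canonRel (n : ℕ) (H : List (ℕ × ℕ)) : List (ℕ × ℕ) :=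
  (pairs n).filter fun x => x ∈ H

/-- The composition of `H` with the transitions labelled by `l`. -/
def stepRel (D : List TransCode) (l : Option ℕ) (H : List (ℕ × ℕ)) : List (ℕ × ℕ) :=
  H.flatMap fun x => (D.filter fun t => t.1 = x.2 ∧ t.2.1 = l).map fun t => (x.1, t.2.2.2)

/-- The composition of `H` with at most `n` transitions labelled by `ε`. -/
def epsClosure (n : ℕ) (D : List TransCode) (H : List (ℕ × ℕ)) : List (ℕ × ℕ) :=
  (fun H => H ++ stepRel D none H)^[n] H

/-- The value of the empty word in the transition monoid. -/
def trackNil (n : ℕ) (D : List TransCode) : List (ℕ × ℕ) :=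
  canonRel n (epsClosure n D ((List.range n).map fun i => (i, i)))

/-- The product of `H` with the value of a letter in the transition monoid. -/
def track (n : ℕ) (D : List TransCode) (l : Option ℕ) (H : List (ℕ × ℕ)) : List (ℕ × ℕ) :=
  if l = none then H else canonRel n (epsClosure n D (stepRel D l H))

section Track

variable {A Q Γ : Type*} {k n m : ℕ} {𝒜 : CounterAutomaton A Q Γ} {α : A ≃ Fin k} {κ : Q ≃ Fin n}
  {γ : Γ ≃ Fin m} {D : List TransCode} {H H' : List (ℕ × ℕ)}

/-- The value of a word in the transition monoid, starting from `H`. -/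
def trackWord (n : ℕ) (D : List TransCode) (α : A ≃ Fin k) (H : List (ℕ × ℕ)) (w : List A) :
    List (ℕ × ℕ) :=
  w.foldl (fun H a => track n D (some (α a : ℕ)) H) H

theorem mem_pairs {x : ℕ × ℕ} : x ∈ pairs n ↔ x.1 < n ∧ x.2 < n := by
  obtain ⟨i, j⟩ := x
  simp [pairs]

theorem mem_canonRel (κ : Q ≃ Fin n) {p q : Q} :
    ((κ p : ℕ), (κ q : ℕ)) ∈ canonRel n H ↔ ((κ p : ℕ), (κ q : ℕ)) ∈ H := by
  simp [canonRel, mem_pairs]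

/-- Filtering one fixed list forgets order, repetitions and pairs out of range, so equality of lists
decides equality of relations. -/
theorem canonRel_eq_iff (κ : Q ≃ Fin n) : canonRel n H = canonRel n H' ↔
    ∀ p q : Q, ((κ p : ℕ), (κ q : ℕ)) ∈ H ↔ ((κ p : ℕ), (κ q : ℕ)) ∈ H' := by
  constructor
  · intro h p q
    rw [← mem_canonRel κ, h, mem_canonRel κ]
  · intro h
    refine List.filter_congr fun x hx => ?_
    rw [mem_pairs] at hx
    have := h (κ.symm ⟨x.1, hx.1⟩) (κ.symm ⟨x.2, hx.2⟩)
    simpa using this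

theorem mem_stepRel (hD : Lists D (Transition.code α κ γ) 𝒜.trans) {l : Option A} {p q : Q} :
    ((κ p : ℕ), (κ q : ℕ)) ∈ stepRel D (l.map fun a => (α a : ℕ)) H ↔
      ∃ t ∈ 𝒜.trans, ((κ p : ℕ), (κ t.src : ℕ)) ∈ H ∧ t.label = l ∧ t.tgt = q := by
  have hinj : Function.Injective (Option.map fun a : A => (α a : ℕ)) :=
    Option.map_injective (Fin.val_injective.comp α.injective)
  simp only [stepRel, List.mem_flatMap, List.mem_map, List.mem_filter, decide_eq_true_eq]
  constructor
  · rintro ⟨⟨a, b⟩, hx, y, ⟨hy, h1, h2⟩, h3⟩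
    obtain ⟨t, ht, rfl⟩ := (hD y).1 hy
    obtain ⟨h3, h4⟩ := Prod.mk.inj h3
    subst h3 h1
    exact ⟨t, ht, hx, hinj h2, κ.injective (Fin.val_injective h4)⟩
  · rintro ⟨t, ht, hp, rfl, rfl⟩
    exact ⟨_, hp, _, ⟨(hD _).2 ⟨t, ht, rfl⟩, rfl, rfl⟩, rfl⟩

/-- The sources along an ε-path are distinct, since a repetition would close a nonempty ε-cycle.
This bounds the number of iterations that `epsClosure` needs. -/
theorem length_le_of_readWord_eq_nil (𝒜 : CounterAutomaton A Q Γ) (κ : Q ≃ Fin n) {p q : Q}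
    {ρ : List (Transition A Q Γ)} (hρ : IsPath 𝒜.trans p ρ q) (hw : readWord ρ = []) :
    ρ.length ≤ n := by
  have hnd : (ρ.map Transition.src).Nodup := by
    clear κ
    induction ρ generalizing p with
    | nil => simp
    | cons t ρ ih =>
      obtain ⟨h1, h2, h3⟩ := hρ
      have hw' : readWord [t] = [] ∧ readWord ρ = [] := by
        rw [← List.append_eq_nil_iff, ← readWord_append]
        exact hw
      rw [List.map_cons, List.nodup_cons]
      refine ⟨fun hmem => ?_, ih h3 hw'.2⟩
      obtain ⟨t', ht', hsrc⟩ := List.mem_map.1 hmem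
      obtain ⟨ρ₁, ρ₂, rfl⟩ := List.append_of_mem ht'
      obtain ⟨r, h4, h5⟩ := isPath_append.1 h3
      have hr : r = t.src := by rw [← hsrc]; exact h5.2.1.symm
      subst hr
      have hw'' : readWord ρ₁ = [] := by
        have := hw'.2
        rw [readWord_append, List.append_eq_nil_iff] at this
        exact this.1
      have := 𝒜.no_eps_cycle t.src (t :: ρ₁) ⟨h1, rfl, h4⟩ (by
        rw [← List.singleton_append, readWord_append, hw'.1, hw'', List.nil_append])
      simp at this
  have h := (hnd.map κ.injective).length_le_card
  simpa using h

/-- After `j` iterations exactly the ε-paths of length at most `j` are covered; `n` iterations cover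
all of them. -/
theorem mem_epsClosure (hD : Lists D (Transition.code α κ γ) 𝒜.trans) {p q : Q} :
    ((κ p : ℕ), (κ q : ℕ)) ∈ epsClosure n D H ↔
      ∃ r, ((κ p : ℕ), (κ r : ℕ)) ∈ H ∧ (r, q) ∈ 𝒜.h [] := by
  have key : ∀ j q, ((κ p : ℕ), (κ q : ℕ)) ∈ (fun H => H ++ stepRel D none H)^[j] H ↔
      ∃ r, ((κ p : ℕ), (κ r : ℕ)) ∈ H ∧
        ∃ ρ, IsPath 𝒜.trans r ρ q ∧ readWord ρ = [] ∧ ρ.length ≤ j := fun j => by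
    induction j with
    | zero =>
      intro q
      constructor
      · intro h
        exact ⟨q, h, [], rfl, rfl, le_rfl⟩
      · rintro ⟨r, h, ρ, hρ, -, hl⟩
        obtain rfl := List.eq_nil_of_length_eq_zero (Nat.le_zero.1 hl)
        rwa [show r = q from hρ] at h
    | succ j ih =>
      intro q
      have hs := mem_stepRel (H := (fun H => H ++ stepRel D none H)^[j] H) hD (l := none) (p := p)
        (q := q)
      rw [Option.map_none] at hs
      rw [Function.iterate_succ_apply', List.mem_append, hs, ih]
      constructor
      · rintro (⟨r, h, ρ, h1, h2, h3⟩ | ⟨t, ht, h, hl, rfl⟩)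
        · exact ⟨r, h, ρ, h1, h2, h3.trans j.le_succ⟩
        · obtain ⟨r, h, ρ, h1, h2, h3⟩ := (ih _).1 h
          refine ⟨r, h, ρ ++ [t], isPath_append.2 ⟨_, h1, ht, rfl, rfl⟩, ?_, by simpa using h3⟩
          rw [readWord_append, h2]
          simp [readWord, hl]
      · rintro ⟨r, h, ρ, h1, h2, h3⟩
        rcases List.eq_nil_or_concat ρ with rfl | ⟨ρ, t, rfl⟩
        · exact Or.inl ⟨r, h, [], h1, h2, Nat.zero_le _⟩
        · rw [List.concat_eq_append] at h1 h2 h3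
          obtain ⟨r', h4, h5, h6, h7⟩ := isPath_append.1 h1
          rw [readWord_append, List.append_eq_nil_iff] at h2
          refine Or.inr ⟨t, h5, (ih _).2 ⟨r, h, ρ, h6 ▸ h4, h2.1, by simpa using h3⟩, ?_, h7⟩
          cases hl : t.label with
          | none => rfl
          | some a => simp [readWord, hl] at h2
  rw [epsClosure, key]
  refine exists_congr fun r => and_congr_right fun _ => ?_
  rw [CounterAutomaton.mem_h]
  exact exists_congr fun ρ => ⟨fun h => ⟨h.1, h.2.1⟩,
    fun h => ⟨h.1, h.2, length_le_of_readWord_eq_nil 𝒜 κ h.1 h.2⟩⟩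

theorem CounterAutomaton.mem_h_singleton (𝒜 : CounterAutomaton A Q Γ) {a : A} {p q : Q} :
    (p, q) ∈ 𝒜.h [a] ↔
      ∃ t ∈ 𝒜.trans, (p, t.src) ∈ 𝒜.h [] ∧ t.label = some a ∧ (t.tgt, q) ∈ 𝒜.h [] := by
  constructor
  · rintro ⟨ρ, hρ, hw⟩
    obtain ⟨ρ₁, t, ρ₂, rfl, h1, h2, h3⟩ := List.filterMap_eq_cons_iff.1 hw
    obtain ⟨r, h4, h5, rfl, h6⟩ := isPath_append.1 hρ
    exact ⟨t, h5, ⟨ρ₁, h4, List.filterMap_eq_nil_iff.2 h1⟩, h2, ρ₂, h6, h3⟩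
  · rintro ⟨t, ht, ⟨ρ₁, h1, h2⟩, hl, ρ₂, h3, h4⟩
    refine ⟨ρ₁ ++ t :: ρ₂, isPath_append.2 ⟨_, h1, ht, rfl, h3⟩, ?_⟩
    rw [readWord_append, h2, List.nil_append, readWord, List.filterMap_cons_some hl]
    exact congrArg _ h4

theorem mem_trackNil (hD : Lists D (Transition.code α κ γ) 𝒜.trans) {p q : Q} :
    ((κ p : ℕ), (κ q : ℕ)) ∈ trackNil n D ↔ (p, q) ∈ 𝒜.h [] := by
  rw [trackNil, mem_canonRel κ, mem_epsClosure hD]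
  constructor
  · rintro ⟨r, hr, h⟩
    obtain ⟨i, -, hi⟩ := List.mem_map.1 hr
    obtain ⟨h1, h2⟩ := Prod.mk.inj hi
    rwa [κ.injective (Fin.val_injective (h1.symm.trans h2))]
  · intro h
    exact ⟨p, List.mem_map.2 ⟨κ p, by simp, rfl⟩, h⟩

theorem mem_trackWord (hD : Lists D (Transition.code α κ γ) 𝒜.trans) {w : List A} {p q : Q} :
    ((κ p : ℕ), (κ q : ℕ)) ∈ trackWord n D α (trackNil n D) w ↔ (p, q) ∈ 𝒜.h w := by
  induction w using List.reverseRecOn generalizing q with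
  | nil => exact mem_trackNil hD
  | append_singleton w a ih =>
    have hs := fun q => mem_stepRel (H := trackWord n D α (trackNil n D) w) hD (l := some a) (p := p)
      (q := q)
    simp only [Option.map_some] at hs
    rw [trackWord, List.foldl_append, List.foldl_cons, List.foldl_nil, track, if_neg (by simp),
      mem_canonRel κ, mem_epsClosure hD, 𝒜.h_append, TransMonoid.mem_mul]
    simp only [𝒜.mem_h_singleton]
    constructor
    · rintro ⟨r, hr, hrq⟩
      obtain ⟨t, ht, h1, h2, rfl⟩ := (hs _).1 hr
      exact ⟨t.src, ih.1 h1, t, ht, ⟨[], rfl, rfl⟩, h2, hrq⟩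
    · rintro ⟨r, hr, t, ht, h1, h2, hrq⟩
      refine ⟨t.tgt, (hs _).2 ⟨t, ht, ih.2 ?_, h2, rfl⟩, hrq⟩
      -- The ε-transitions before the letter are absorbed because the relation tracked so far is
      -- already closed under them.
      rw [← List.append_nil w, 𝒜.h_append]
      exact ⟨r, hr, h1⟩

/-- Both sides are canonical lists, so the test on codes at the end of a loop is exact. -/
theorem trackWord_eq_iff (hD : Lists D (Transition.code α κ γ) 𝒜.trans) {e : TransMonoid Q}
    {le : List (ℕ × ℕ)} (he : e.HasCode κ le) (w : List A) :
    trackWord n D α (trackNil n D) w = canonRel n le ↔ 𝒜.h w = e := by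
  have hcan : ∃ H, trackWord n D α (trackNil n D) w = canonRel n H := by
    induction w using List.reverseRecOn with
    | nil => exact ⟨_, rfl⟩
    | append_singleton w a _ =>
      exact ⟨_, by rw [trackWord, List.foldl_append, List.foldl_cons, List.foldl_nil, track,
        if_neg (by simp)]⟩
  have hle : ∀ p q : Q, ((κ p : ℕ), (κ q : ℕ)) ∈ le ↔ (p, q) ∈ e := fun p q => by
    rw [he]
    constructor
    · rintro ⟨⟨p', q'⟩, hx, hp⟩
      obtain ⟨h1, h2⟩ := Prod.mk.inj hp
      rw [← κ.injective (Fin.val_injective h1), ← κ.injective (Fin.val_injective h2)]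
      exact hx
    · intro h
      exact ⟨_, h, rfl⟩
  obtain ⟨H, hH⟩ := hcan
  rw [hH, canonRel_eq_iff κ]
  simp only [hle, ← mem_canonRel κ (H := H), ← hH, mem_trackWord hD]
  exact ⟨fun h => TransMonoid.ext fun x => h x.1 x.2, fun h p q => by rw [h]⟩

end Track

/-! ### The automaton for a linked pair, on codes -/

/-- Codes of states: the base point of the loop, the current state, the counters that are masked,
the counters that have been reset, the value of the word read so far. -/
abbrev StateCode : Type := ℕ × ℕ × List ℕ × List ℕ × List (ℕ × ℕ)

/-- A list of sublists of `l` that contains all those that are given by filters. -/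
def filterings {X : Type*} (l : List X) : List (List X) :=
  l.foldr (fun a L => L ++ L.map (a :: ·)) [[]]

theorem filter_mem_filterings {X : Type*} (l : List X) (p : X → Bool) :
    l.filter p ∈ filterings l := by
  induction l with
  | nil => simp [filterings]
  | cons a l ih =>
    have h : filterings (a :: l) = filterings l ++ (filterings l).map (a :: ·) := rfl
    rw [h, List.mem_append, List.filter_cons]
    split
    · exact Or.inr (List.mem_map.2 ⟨_, ih, rfl⟩)
    · exact Or.inl ih

/-- The sets of counters that may be masked. -/
def maskCodes : Mode → ℕ → List (List ℕ)
  | .B, _ => [[]]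
  | .S, m => filterings (List.range m)

/-- A list of codes of states that contains all those that are needed. -/
def stateCodes (T : Mode) (n m : ℕ) : List StateCode :=
  (List.range n).flatMap fun i => (List.range n).flatMap fun j => (maskCodes T m).flatMap fun X =>
    (filterings (List.range m)).flatMap fun R => (filterings (pairs n)).map fun H => (i, j, X, R, H)

/-- The number of a state; the number `0` is reserved for the final state. -/
def stateNum (st : StateCode) : ℕ :=
  Encodable.encode st + 1

/-- The number of states. -/
def stateBound (T : Mode) (n m : ℕ) : ℕ :=
  (stateCodes T n m).foldr (fun st b => max (stateNum st) b) 0 + 1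

/-- The state that is reached from `st` by the transition `t`. -/
def nextState (n m : ℕ) (D : List TransCode) (st : StateCode) (t : TransCode) : StateCode :=
  (st.1, t.2.2.2, st.2.2.1,
    (List.range m).filter fun c => c ∈ st.2.2.2.1 ∨ t.2.2.1.getD c 0 = 2,
    track n D t.2.1 st.2.2.2.2)

/-- The transition that lifts `t` to the state `st`. -/
def liftTrans (n m : ℕ) (D : List TransCode) (st : StateCode) (t : TransCode) : TransCode :=
  (stateNum st, t.2.1,
    (List.range m).map fun c =>
      if c ∈ st.2.2.1 ∧ c ∉ st.2.2.2.1 then 0 else t.2.2.1.getD c 0,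
    stateNum (nextState n m D st t))

/-- The code of the final operation on the counter `c` if the counters in `X` are masked. -/
def finalOpCode : Mode → List ℕ → ℕ → ℕ
  | .B, _, _ => 2
  | .S, X, c => if c ∈ X then 2 else 0

/-- The transition from `st` to the final state. -/
def finalTrans (T : Mode) (m : ℕ) (st : StateCode) : TransCode :=
  (stateNum st, none, (List.range m).map (finalOpCode T st.2.2.1), 0)

/-- The condition for a transition from `st` to the final state. -/
def IsLoopEnd (n m : ℕ) (le : List (ℕ × ℕ)) (st : StateCode) : Prop :=
  st.2.1 = st.1 ∧ (List.range m).filter (fun c => c ∈ st.2.2.2.1) = List.range m ∧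
    st.2.2.2.2 = canonRel n le

instance (n m : ℕ) (le : List (ℕ × ℕ)) : DecidablePred (IsLoopEnd n m le) := fun _ =>
  inferInstanceAs (Decidable (_ ∧ _ ∧ _))

/-- The list of the transitions. -/
def transCodes (T : Mode) (n m : ℕ) (D : List TransCode) (le : List (ℕ × ℕ)) : List TransCode :=
  ((stateCodes T n m).flatMap fun st =>
    (D.filter fun t => t.1 = st.2.1).map fun t => liftTrans n m D st t) ++
  ((stateCodes T n m).filter fun st => IsLoopEnd n m le st).map fun st => finalTrans T m st

/-- The list of the initial states. -/
def initCodes (T : Mode) (n m : ℕ) (I : List ℕ) (D : List TransCode) (ls : List (ℕ × ℕ)) : List ℕ :=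
  (ls.filter fun x => x.1 ∈ I).flatMap fun x =>
    (maskCodes T m).map fun X => stateNum (x.2, x.2, X, [], trackNil n D)

/-- The code of the automaton for a linked pair. -/
def typeCode (T : Mode) (x : AutCode × List (ℕ × ℕ) × List (ℕ × ℕ)) : FinAutCode :=
  ((x.1.1, stateBound T x.1.2.1 x.1.2.2.1, x.1.2.2.1,
    initCodes T x.1.2.1 x.1.2.2.1 x.1.2.2.2.1 x.1.2.2.2.2 x.2.1,
    transCodes T x.1.2.1 x.1.2.2.1 x.1.2.2.2.2 x.2.2), [0])

section Codes

variable {T : Mode} {n m : ℕ} {D : List TransCode} {le : List (ℕ × ℕ)}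

theorem stateNum_injective : Function.Injective stateNum := fun _ _ h =>
  Encodable.encode_injective (Nat.succ_injective h)

theorem stateNum_lt {st : StateCode} (h : st ∈ stateCodes T n m) :
    stateNum st < stateBound T n m := by
  rw [stateBound, Nat.lt_succ_iff]
  generalize stateCodes T n m = l at h
  induction l with
  | nil => simp at h
  | cons a l ih =>
    rw [List.foldr_cons]
    rcases List.mem_cons.1 h with rfl | h
    · exact le_max_left _ _
    · exact (ih h).trans (le_max_right _ _)

theorem mem_stateCodes {i j : ℕ} {X R : List ℕ} {H : List (ℕ × ℕ)} :
    (i, j, X, R, H) ∈ stateCodes T n m ↔ i < n ∧ j < n ∧ X ∈ maskCodes T m ∧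
      R ∈ filterings (List.range m) ∧ H ∈ filterings (pairs n) := by
  simp only [stateCodes, List.mem_flatMap, List.mem_map, List.mem_range, Prod.mk.injEq]
  constructor
  · rintro ⟨i, hi, j, hj, X, hX, R, hR, H, hH, rfl, rfl, rfl, rfl, rfl⟩
    exact ⟨hi, hj, hX, hR, hH⟩
  · rintro ⟨hi, hj, hX, hR, hH⟩
    exact ⟨i, hi, j, hj, X, hX, R, hR, H, hH, rfl, rfl, rfl, rfl, rfl⟩

theorem track_mem_filterings {l : Option ℕ} {H : List (ℕ × ℕ)} (h : H ∈ filterings (pairs n)) :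
    track n D l H ∈ filterings (pairs n) := by
  rw [track]
  split
  · exact h
  · exact filter_mem_filterings _ _

theorem nextState_mem {st : StateCode} (h : st ∈ stateCodes T n m) {t : TransCode}
    (ht : t.2.2.2 < n) : nextState n m D st t ∈ stateCodes T n m := by
  obtain ⟨i, j, X, R, H⟩ := st
  rw [mem_stateCodes] at h
  exact mem_stateCodes.2 ⟨h.1, ht, h.2.2.1, filter_mem_filterings _ _,
    track_mem_filterings h.2.2.2.2⟩

theorem mem_transCodes {y : TransCode} : y ∈ transCodes T n m D le ↔
    (∃ st ∈ stateCodes T n m, ∃ t ∈ D, t.1 = st.2.1 ∧ y = liftTrans n m D st t) ∨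
      ∃ st ∈ stateCodes T n m, IsLoopEnd n m le st ∧ y = finalTrans T m st := by
  simp only [transCodes, List.mem_append, List.mem_flatMap, List.mem_map, List.mem_filter,
    decide_eq_true_eq, and_assoc, eq_comm (a := y)]

theorem CounterOp.code_injective : Function.Injective CounterOp.code := by
  intro a b h
  cases a <;> cases b <;> simp [CounterOp.code] at h ⊢

theorem map_range_eq_ofFn_iff {f : ℕ → ℕ} {g : Fin m → ℕ} :
    List.ofFn g = (List.range m).map f ↔ ∀ i : Fin m, g i = f i := by
  constructor
  · intro h i
    have := congrArg (fun l => l[(i : ℕ)]?) h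
    simpa using this
  · intro h
    refine List.ext_getElem (by simp) fun i h1 h2 => ?_
    simpa using h ⟨i, by simpa using h1⟩

end Codes

/-! ### Correctness of the coded automaton -/

section Recognition

variable {A Q Γ : Type*} {k n m : ℕ} {𝒜 : CounterAutomaton A Q Γ} {α : A ≃ Fin k} {κ : Q ≃ Fin n}
  {γ : Γ ≃ Fin m} {D : List TransCode} {T : Mode} {le ls : List (ℕ × ℕ)} {I : List ℕ} {N : ℕ}

/-- The transitions with a code in `D'`. -/
def decodedTrans (α : A ≃ Fin k) (N m : ℕ) (D' : List TransCode) :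
    Set (Transition A (Fin N) (Fin m)) :=
  {t | t.code α (Equiv.refl _) (Equiv.refl _) ∈ D'}

theorem liftTrans_op (γ : Γ ≃ Fin m) (c : Γ) (t : Transition A Q Γ) (X R : List ℕ) :
    (if (γ c : ℕ) ∈ X ∧ (γ c : ℕ) ∉ R then 0
      else (t.code α κ γ).2.2.1.getD (γ c) 0) =
    (bif !decide ((γ c : ℕ) ∈ X) || decide ((γ c : ℕ) ∈ R) then t.op c else .nil).code := by
  by_cases h1 : (γ c : ℕ) ∈ X <;> by_cases h2 : (γ c : ℕ) ∈ R <;>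
    simp [h1, h2, Transition.code, CounterOp.code]

theorem code_eq_liftTrans_iff {st : StateCode} {t₀ : Transition A Q Γ}
    {t : Transition A (Fin N) (Fin m)} :
    t.code α (Equiv.refl _) (Equiv.refl _) = liftTrans n m D st (t₀.code α κ γ) ↔
      (t.src : ℕ) = stateNum st ∧ t.label = t₀.label ∧
      (∀ c : Γ, t.op (γ c) = bif !decide ((γ c : ℕ) ∈ st.2.2.1) || decide ((γ c : ℕ) ∈ st.2.2.2.1)
        then t₀.op c else .nil) ∧
      (t.tgt : ℕ) = stateNum (nextState n m D st (t₀.code α κ γ)) := by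
  have hinj : Function.Injective (Option.map fun a : A => (α a : ℕ)) :=
    Option.map_injective (Fin.val_injective.comp α.injective)
  have h1 : t.label.map (fun a => (α a : ℕ)) = t₀.label.map (fun a => (α a : ℕ)) ↔
      t.label = t₀.label := hinj.eq_iff
  have h2 : (∀ i : Fin m, (t.op i).code = if (i : ℕ) ∈ st.2.2.1 ∧ (i : ℕ) ∉ st.2.2.2.1 then 0
      else (t₀.code α κ γ).2.2.1.getD i 0) ↔ ∀ c : Γ, t.op (γ c) =
        bif !decide ((γ c : ℕ) ∈ st.2.2.1) || decide ((γ c : ℕ) ∈ st.2.2.2.1)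
        then t₀.op c else .nil := by
    rw [← γ.forall_congr_right]
    refine forall_congr' fun c => ?_
    rw [liftTrans_op, CounterOp.code_injective.eq_iff]
  rw [← h1, ← h2, ← map_range_eq_ofFn_iff (g := fun i => (t.op i).code)
    (f := fun i => if i ∈ st.2.2.1 ∧ i ∉ st.2.2.2.1 then 0 else (t₀.code α κ γ).2.2.1.getD i 0)]
  simp only [Transition.code, liftTrans, Prod.mk.injEq]
  rfl

theorem code_eq_finalTrans_iff {st : StateCode} {t : Transition A (Fin N) (Fin m)} :
    t.code α (Equiv.refl _) (Equiv.refl _) = finalTrans T m st ↔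
      (t.src : ℕ) = stateNum st ∧ t.label = none ∧
      (∀ c : Γ, t.op (γ c) = T.finalOp (decide ((γ c : ℕ) ∈ st.2.2.1))) ∧ (t.tgt : ℕ) = 0 := by
  have h2 : (∀ i : Fin m, (t.op i).code = finalOpCode T st.2.2.1 i) ↔
      ∀ c : Γ, t.op (γ c) = T.finalOp (decide ((γ c : ℕ) ∈ st.2.2.1)) := by
    rw [← γ.forall_congr_right]
    refine forall_congr' fun c => ?_
    rw [← CounterOp.code_injective.eq_iff]
    refine Eq.congr_right ?_
    cases T with
    | B => rfl
    | S => by_cases h : (γ c : ℕ) ∈ st.2.2.1 <;> simp [finalOpCode, Mode.finalOp, h, CounterOp.code]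
  rw [← h2, ← map_range_eq_ofFn_iff]
  simp only [Transition.code, finalTrans, Prod.mk.injEq, Option.map_eq_none_iff]
  rfl

theorem mem_decodedTrans (hD : Lists D (Transition.code α κ γ) 𝒜.trans)
    {t : Transition A (Fin N) (Fin m)} :
    t ∈ decodedTrans α N m (transCodes T n m D le) ↔
      (∃ st ∈ stateCodes T n m, ∃ t₀ ∈ 𝒜.trans, (κ t₀.src : ℕ) = st.2.1 ∧
        (t.src : ℕ) = stateNum st ∧ t.label = t₀.label ∧
        (∀ c : Γ, t.op (γ c) =
          bif !decide ((γ c : ℕ) ∈ st.2.2.1) || decide ((γ c : ℕ) ∈ st.2.2.2.1)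
          then t₀.op c else .nil) ∧
        (t.tgt : ℕ) = stateNum (nextState n m D st (t₀.code α κ γ))) ∨
      ∃ st ∈ stateCodes T n m, IsLoopEnd n m le st ∧ (t.src : ℕ) = stateNum st ∧ t.label = none ∧
        (∀ c : Γ, t.op (γ c) = T.finalOp (decide ((γ c : ℕ) ∈ st.2.2.1))) ∧ (t.tgt : ℕ) = 0 := by
  change t.code α (Equiv.refl _) (Equiv.refl _) ∈ transCodes T n m D le ↔ _
  rw [mem_transCodes]
  refine or_congr (exists_congr fun st => and_congr_right fun _ => ?_)
    (exists_congr fun st => and_congr_right fun _ => and_congr_right fun _ =>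
      code_eq_finalTrans_iff)
  constructor
  · rintro ⟨y, hy, h1, h2⟩
    obtain ⟨t₀, ht₀, rfl⟩ := (hD y).1 hy
    exact ⟨t₀, ht₀, h1, code_eq_liftTrans_iff.1 h2⟩
  · rintro ⟨t₀, ht₀, h1, h2⟩
    exact ⟨_, (hD _).2 ⟨t₀, ht₀, rfl⟩, h1, code_eq_liftTrans_iff.2 h2⟩

theorem nextState_code_mem {st : StateCode} (h : st ∈ stateCodes T n m) (t : Transition A Q Γ) :
    nextState n m D st (t.code α κ γ) ∈ stateCodes T n m :=
  nextState_mem h (κ t.tgt).2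

theorem mem_nextState_resets (c : Γ) (R : List ℕ) (t : Transition A Q Γ) :
    decide ((γ c : ℕ) ∈
      ((List.range m).filter fun i => i ∈ R ∨ (t.code α κ γ).2.2.1.getD i 0 = 2)) =
      (decide ((γ c : ℕ) ∈ R) || (t.op c).isReset) := by
  have h : ∀ a : CounterOp, a.code = 2 ↔ a.isReset = true := by
    intro a
    cases a <;> simp [CounterOp.code, CounterOp.isReset]
  simp [Transition.code, h]

theorem track_label (α : A ≃ Fin k) (H : List (ℕ × ℕ)) (t : Transition A Q Γ)
    (ρ : List (Transition A Q Γ)) :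
    trackWord n D α (track n D (t.label.map fun a => (α a : ℕ)) H) (readWord ρ) =
      trackWord n D α H (readWord (t :: ρ)) := by
  cases h : t.label with
  | none => simp [track, readWord, h]
  | some a => simp [trackWord, readWord, h]

theorem isLoopEnd_iff {i j : ℕ} {X R : List ℕ} {H : List (ℕ × ℕ)} (γ : Γ ≃ Fin m) :
    IsLoopEnd n m le (i, j, X, R, H) ↔
      j = i ∧ (∀ c : Γ, (γ c : ℕ) ∈ R) ∧ H = canonRel n le := by
  refine and_congr Iff.rfl (and_congr ?_ Iff.rfl)
  rw [List.filter_eq_self]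
  constructor
  · intro h c
    simpa using h (γ c) (by simp)
  · intro h i hi
    simpa using h (γ.symm ⟨i, List.mem_range.1 hi⟩)

theorem readWord_cons_congr {Q' Γ' : Type*} {t : Transition A Q Γ} {t' : Transition A Q' Γ'}
    {ρ : List (Transition A Q Γ)} {ρ' : List (Transition A Q' Γ')} (h : t.label = t'.label)
    (h' : readWord ρ = readWord ρ') : readWord (t :: ρ) = readWord (t' :: ρ') := by
  simp only [readWord, List.filterMap_cons] at h' ⊢
  rw [h, h']

/-- Erasing the bookkeeping projects a run that reaches the final state to a loop in `𝒜`. The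
induction is on suffixes of the run, hence the arbitrary `R` and `H`: resets made earlier are in
`R`, and `H` is the value of the prefix. -/
theorem exists_loop_of_isPath (hD : Lists D (Transition.code α κ γ) 𝒜.trans)
    {ρ' : List (Transition A (Fin N) (Fin m))} {p f : Fin N} (hf : (f : ℕ) = 0) {q₀ q : Q}
    {X R : List ℕ} {H : List (ℕ × ℕ)} (hp : (p : ℕ) = stateNum (κ q₀, κ q, X, R, H))
    (hρ' : IsPath (decodedTrans α N m (transCodes T n m D le)) p ρ' f) :
    ∃ ρ, IsPath 𝒜.trans q ρ q₀ ∧ readWord ρ = readWord ρ' ∧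
      (∀ c, (decide ((γ c : ℕ) ∈ R) || (opsOf c ρ).any CounterOp.isReset) = true) ∧
      (∀ c, opsOf (γ c) ρ' = maskOps (!decide ((γ c : ℕ) ∈ X) || decide ((γ c : ℕ) ∈ R))
        (opsOf c ρ) ++ [T.finalOp (decide ((γ c : ℕ) ∈ X))]) ∧
      trackWord n D α H (readWord ρ) = canonRel n le := by
  induction ρ' generalizing p q R H with
  | nil =>
    rw [show p = f from hρ', hf] at hp
    exact absurd hp (Nat.succ_ne_zero _).symm
  | cons t ρ' ih =>
    obtain ⟨ht, hsrc, hρ'⟩ := hρ'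
    rw [← hsrc] at hp
    rcases (mem_decodedTrans hD).1 ht with
      ⟨st, -, t₀, ht₀, h1, h2, h3, h4, h5⟩ | ⟨st, -, hend, h2, h3, h4, h5⟩
    · obtain rfl := stateNum_injective (hp.symm.trans h2)
      obtain rfl : t₀.src = q := κ.injective (Fin.val_injective h1)
      obtain ⟨ρ, h6, h7, h8, h9, h10⟩ := ih (q := t₀.tgt) h5 hρ'
      refine ⟨t₀ :: ρ, ⟨ht₀, rfl, h6⟩, readWord_cons_congr h3.symm h7, fun c => ?_, fun c => ?_,
        ?_⟩
      · have := h8 c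
        rw [mem_nextState_resets c R t₀] at this
        simpa [opsOf, or_assoc] using this
      · have := h9 c
        rw [mem_nextState_resets c R t₀] at this
        simp only [opsOf, List.map_cons, maskOps, List.cons_append, h4] at this ⊢
        rw [this]
        simp [Bool.or_assoc]
      · rw [← track_label]
        exact h10
    · obtain rfl := stateNum_injective (hp.symm.trans h2)
      rw [isLoopEnd_iff γ] at hend
      obtain ⟨h6, h7, h8⟩ := hend
      -- State numbers are positive, so no transition leaves the final state `0`.
      have hnil : ρ' = [] := by
        cases ρ' with
        | nil => rfl
        | cons t' ρ' =>
          obtain ⟨ht', hsrc', -⟩ := hρ'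
          rw [← hsrc'] at h5
          rcases (mem_decodedTrans hD).1 ht' with
            ⟨st, -, t₀, -, -, h, -⟩ | ⟨st, -, -, h, -⟩ <;>
          exact absurd (h5.symm.trans h) (Nat.succ_ne_zero _).symm
      subst hnil
      refine ⟨[], κ.injective (Fin.val_injective h6), ?_, fun c => by simp [h7 c], fun c => ?_, h8⟩
      · simp [readWord, h3]
      · simp [opsOf, maskOps, h4]

/-- The converse lifting is deterministic. Membership in `stateCodes` is carried along to keep the
numbers of states below `stateBound`. -/
theorem exists_isPath_of_loop (hD : Lists D (Transition.code α κ γ) 𝒜.trans)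
    {ρ : List (Transition A Q Γ)} {f : Fin (stateBound T n m)} (hf : (f : ℕ) = 0) {q₀ q : Q}
    {X R : List ℕ} {H : List (ℕ × ℕ)} {p : Fin (stateBound T n m)}
    (hst : ((κ q₀ : ℕ), (κ q : ℕ), X, R, H) ∈ stateCodes T n m)
    (hp : (p : ℕ) = stateNum (κ q₀, κ q, X, R, H)) (hρ : IsPath 𝒜.trans q ρ q₀)
    (hr : ∀ c, (decide ((γ c : ℕ) ∈ R) || (opsOf c ρ).any CounterOp.isReset) = true)
    (hH : trackWord n D α H (readWord ρ) = canonRel n le) :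
    ∃ ρ', IsPath (decodedTrans α (stateBound T n m) m (transCodes T n m D le)) p ρ' f ∧
      readWord ρ' = readWord ρ ∧
      ∀ c, opsOf (γ c) ρ' = maskOps (!decide ((γ c : ℕ) ∈ X) || decide ((γ c : ℕ) ∈ R))
        (opsOf c ρ) ++ [T.finalOp (decide ((γ c : ℕ) ∈ X))] := by
  induction ρ generalizing p q R H with
  | nil =>
    obtain rfl : q = q₀ := hρ
    refine ⟨[⟨p, none, fun i => T.finalOp (decide ((i : ℕ) ∈ X)), f⟩], ⟨?_, rfl, rfl⟩, rfl,
      fun c => by simp [opsOf, maskOps]⟩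
    exact (mem_decodedTrans hD).2 (Or.inr ⟨_, hst, (isLoopEnd_iff γ).2
      ⟨rfl, fun c => by simpa [opsOf] using hr c, hH⟩, hp, rfl, fun c => rfl, hf⟩)
  | cons t₀ ρ ih =>
    obtain ⟨ht₀, rfl, hρ⟩ := hρ
    have hnext := nextState_code_mem (D := D) (α := α) (κ := κ) (γ := γ) hst t₀
    obtain ⟨ρ', h1, h2, h3⟩ := ih (p := ⟨_, stateNum_lt hnext⟩) (q := t₀.tgt) hnext rfl hρ
      (fun c => by
        rw [mem_nextState_resets c R t₀]
        simpa [opsOf, or_assoc] using hr c)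
      (by rw [← hH, ← track_label]; rfl)
    refine ⟨⟨p, t₀.label, fun i =>
      bif !decide ((i : ℕ) ∈ X) || decide ((i : ℕ) ∈ R) then t₀.op (γ.symm i) else .nil, _⟩ :: ρ',
      ⟨?_, rfl, h1⟩, readWord_cons_congr rfl h2, fun c => ?_⟩
    · exact (mem_decodedTrans hD).2 (Or.inl ⟨_, hst, t₀, ht₀, rfl, hp, rfl, fun c => by simp, rfl⟩)
    · have := h3 c
      rw [mem_nextState_resets c R t₀] at this
      simp only [opsOf, List.map_cons, maskOps, List.cons_append] at this ⊢
      rw [this]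
      simp [Bool.or_assoc]

/-- The state `0` has no outgoing transitions, so a nonempty cycle avoids it and projects to a cycle
of `𝒜` with the same length and word. -/
theorem decodedTrans_no_eps_cycle (hD : Lists D (Transition.code α κ γ) 𝒜.trans) {p : Fin N}
    {ρ' : List (Transition A (Fin N) (Fin m))}
    (hρ' : IsPath (decodedTrans α N m (transCodes T n m D le)) p ρ' p)
    (hw : readWord ρ' = []) : ρ' = [] := by
  have h0 : ∀ {ρ' : List (Transition A (Fin N) (Fin m))} {p p' : Fin N}, (p : ℕ) = 0 →
      IsPath (decodedTrans α N m (transCodes T n m D le)) p ρ' p' → ρ' = [] := by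
    intro ρ' p p' hp hρ'
    cases ρ' with
    | nil => rfl
    | cons t ρ' =>
      obtain ⟨ht, hsrc, -⟩ := hρ'
      rw [← hsrc] at hp
      rcases (mem_decodedTrans hD).1 ht with ⟨st, -, t₀, -, -, h, -⟩ | ⟨st, -, -, h, -⟩ <;>
      exact absurd (hp.symm.trans h) (Nat.succ_ne_zero _).symm
  have key : ∀ {ρ' : List (Transition A (Fin N) (Fin m))} {p p' : Fin N} {st : StateCode} {q : Q},
      (p : ℕ) = stateNum st → st.2.1 = κ q → (p' : ℕ) ≠ 0 →
      IsPath (decodedTrans α N m (transCodes T n m D le)) p ρ' p' →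
      ∃ st' q' ρ, (p' : ℕ) = stateNum st' ∧ st'.2.1 = κ q' ∧ IsPath 𝒜.trans q ρ q' ∧
        readWord ρ = readWord ρ' ∧ ρ.length = ρ'.length := by
    intro ρ'
    induction ρ' with
    | nil =>
      rintro p p' st q hp hq - hρ'
      obtain rfl : p = p' := hρ'
      exact ⟨st, q, [], hp, hq, rfl, rfl, rfl⟩
    | cons t ρ' ih =>
      rintro p p' st q hp hq hp' ⟨ht, rfl, hρ'⟩
      rcases (mem_decodedTrans hD).1 ht with
        ⟨st, -, t₀, ht₀, h1, h2, h3, -, h5⟩ | ⟨st, -, -, -, -, -, h5⟩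
      · obtain rfl := stateNum_injective (hp.symm.trans h2)
        obtain rfl : t₀.src = q := κ.injective (Fin.val_injective (h1.trans hq))
        obtain ⟨st', q', ρ, h6, h7, h8, h9, h10⟩ := ih (q := t₀.tgt) h5 rfl hp' hρ'
        exact ⟨st', q', t₀ :: ρ, h6, h7, ⟨ht₀, rfl, h8⟩, readWord_cons_congr h3.symm h9,
          by simp [h10]⟩
      -- A final transition leads to the dead end `0`, whereas the endpoint is not `0`.
      · obtain rfl := h0 h5 hρ'
        exact absurd (show (p' : ℕ) = 0 from (show t.tgt = p' from hρ') ▸ h5) hp'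
  by_cases hp : (p : ℕ) = 0
  · exact h0 hp hρ'
  cases ρ' with
  | nil => rfl
  | cons t ρ' =>
    have hsrc : t.src = p := hρ'.2.1
    obtain ⟨st, q, hst, hq⟩ : ∃ (st : StateCode) (q : Q), (p : ℕ) = stateNum st ∧ st.2.1 = κ q := by
      rcases (mem_decodedTrans hD).1 hρ'.1 with ⟨st, h, t₀, -, h1, h2, -⟩ | ⟨⟨i, j, st⟩, h, -, h2, -⟩
      · exact ⟨st, t₀.src, hsrc ▸ h2, h1.symm⟩
      · refine ⟨_, κ.symm ⟨j, (mem_stateCodes.1 h).2.1⟩, hsrc ▸ h2, ?_⟩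
        simp
    obtain ⟨st', q', ρ, h1, h2, h3, h4, h5⟩ := key hst hq hp hρ'
    obtain rfl := stateNum_injective (hst.symm.trans h1)
    obtain rfl : q = q' := κ.injective (Fin.val_injective (hq.symm.trans h2))
    have := 𝒜.no_eps_cycle q ρ h3 (h4.trans hw)
    rw [this] at h5
    simp at h5

/-- The automaton for a linked pair. -/
def typeAut (T : Mode) (I : List ℕ) (hD : Lists D (Transition.code α κ γ) 𝒜.trans)
    (ls le : List (ℕ × ℕ)) : FinCounterAutomaton A (Fin (stateBound T n m)) (Fin m) where
  init := {p | (p : ℕ) ∈ initCodes T n m I D ls}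
  trans := decodedTrans α (stateBound T n m) m (transCodes T n m D le)
  no_eps_cycle _ _ := decodedTrans_no_eps_cycle hD
  final := {p | (p : ℕ) = 0}

theorem mem_initCodes {y : ℕ} : y ∈ initCodes T n m I D ls ↔
    ∃ x ∈ ls, x.1 ∈ I ∧ ∃ X ∈ maskCodes T m, y = stateNum (x.2, x.2, X, [], trackNil n D) := by
  simp only [initCodes, List.mem_flatMap, List.mem_map, List.mem_filter, decide_eq_true_eq,
    and_assoc, eq_comm (a := y)]

theorem initState_mem {i : ℕ} (hi : i < n) {X : List ℕ} (hX : X ∈ maskCodes T m) :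
    (i, i, X, [], trackNil n D) ∈ stateCodes T n m := by
  have h : [] ∈ filterings (List.range m) := by
    simpa using filter_mem_filterings (List.range m) fun _ => false
  exact mem_stateCodes.2 ⟨hi, hi, hX, h, filter_mem_filterings _ _⟩

theorem allowsMask_of_mem {X : List ℕ} (hX : X ∈ maskCodes T m) (i : ℕ) :
    T.AllowsMask (decide (i ∈ X)) := by
  cases T with
  | B =>
    rw [List.mem_singleton.1 hX]
    simp [Mode.AllowsMask]
  | S => trivial

theorem exists_maskCode (γ : Γ ≃ Fin m) {x : Γ → Bool} (hx : ∀ c, T.AllowsMask (x c)) :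
    ∃ X ∈ maskCodes T m, ∀ c, decide ((γ c : ℕ) ∈ X) = x c := by
  cases T with
  | B => exact ⟨[], List.mem_singleton.2 rfl, fun c => by simp [show x c = false from hx c]⟩
  | S =>
    classical
    refine ⟨(List.range m).filter fun i => decide (∃ c, (γ c : ℕ) = i ∧ x c = true),
      filter_mem_filterings _ _, fun c => ?_⟩
    have h : (∃ c', (γ c' : ℕ) = γ c ∧ x c' = true) ↔ x c = true :=
      ⟨fun ⟨c', h, hx⟩ => by rwa [← γ.injective (Fin.val_injective h)], fun hx => ⟨c, rfl, hx⟩⟩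
    simp only [List.mem_filter, List.mem_range, Fin.is_lt, true_and, h,
      Bool.decide_eq_true]

theorem mem_list_of_lists {s : TransMonoid Q} (hs : s.HasCode κ ls) {x : ℕ × ℕ} :
    x ∈ ls ↔ ∃ p q, (p, q) ∈ s ∧ x = (↑(κ p), ↑(κ q)) := by
  rw [hs]
  exact ⟨fun ⟨y, hy, h⟩ => ⟨y.1, y.2, hy, h.symm⟩, fun ⟨p, q, h, hx⟩ => ⟨(p, q), h, hx.symm⟩⟩

theorem acceptLang_typeAut (hI : Lists I (fun q => (κ q : ℕ)) 𝒜.init)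
    (hD : Lists D (Transition.code α κ γ) 𝒜.trans) {s e : TransMonoid Q} (hs : s.HasCode κ ls)
    (he : e.HasCode κ le) (t : ℕ) :
    (typeAut T I hD ls le).acceptLang T t = 𝒜.levelLang T s e t := by
  have hinit : ∀ q, (κ q : ℕ) ∈ I ↔ q ∈ 𝒜.init := fun q => by
    rw [hI]
    exact ⟨fun ⟨q', h, h'⟩ => κ.injective (Fin.val_injective h') ▸ h, fun h => ⟨q, h, rfl⟩⟩
  -- At the initial state no counter has been reset, so the mask flag reduces to the guessed mask
  -- and the run itself must supply a reset of every counter.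
  have hgood : ∀ {X : List ℕ} {c : Γ} {o o' : List CounterOp},
      o' = maskOps (!decide ((γ c : ℕ) ∈ X) || decide ((γ c : ℕ) ∈ ([] : List ℕ))) o ++
        [T.finalOp (decide ((γ c : ℕ) ∈ X))] →
      (decide ((γ c : ℕ) ∈ ([] : List ℕ)) || o.any CounterOp.isReset) = true →
      (GoodOps T (decide ((γ c : ℕ) ∈ X)) t o ↔ AllResets (T.Admits t) 0 o') := by
    intro X c o o' ho hr
    rw [decide_eq_false List.not_mem_nil, Bool.or_false] at ho
    rw [decide_eq_false List.not_mem_nil, Bool.false_or] at hr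
    rw [GoodOps, ho]
    exact and_iff_right hr
  ext w
  constructor
  · rintro ⟨ρ', ⟨p, hp, f, hf, hρ', rfl⟩, hall⟩
    obtain ⟨x, hx, hxI, X, hX, hpX⟩ := mem_initCodes.1 hp
    obtain ⟨p₀, q, hpq, rfl⟩ := (mem_list_of_lists hs).1 hx
    obtain ⟨ρ, h1, h2, h3, h4, h5⟩ := exists_loop_of_isPath hD hf hpX hρ'
    refine ⟨q, fun c => decide ((γ c : ℕ) ∈ X), ⟨p₀, (hinit _).1 hxI, hpq⟩,
      fun c => allowsMask_of_mem hX _, ?_, ρ, h1, h2, fun c => ?_⟩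
    · rw [← h2]
      exact (trackWord_eq_iff hD he _).1 h5
    · exact (hgood (h4 c) (h3 c)).2 (hall _)
  · rintro ⟨q, x, ⟨p₀, hp₀, hpq⟩, hx, hw, ρ, h1, rfl, h2⟩
    obtain ⟨X, hX, hXx⟩ := exists_maskCode γ hx
    have hst := initState_mem (D := D) (κ q).2 hX
    have hr : ∀ c, (decide ((γ c : ℕ) ∈ ([] : List ℕ)) ||
        (opsOf c ρ).any CounterOp.isReset) = true := fun c => by simp [(h2 c).1]
    obtain ⟨ρ', h3, h4, h5⟩ := exists_isPath_of_loop (T := T) (f := ⟨0, Nat.succ_pos _⟩)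
      (p := ⟨_, stateNum_lt hst⟩) hD rfl hst rfl h1 hr ((trackWord_eq_iff hD he _).2 hw)
    refine ⟨ρ', ⟨_, ?_, _, rfl, h3, h4⟩, fun c => ?_⟩
    · exact mem_initCodes.2 ⟨_, (mem_list_of_lists hs).2 ⟨p₀, q, hpq, rfl⟩, (hinit _).2 hp₀, X, hX,
        rfl⟩
    · obtain ⟨c, rfl⟩ := γ.surjective c
      refine (hgood (h5 c) (hr c)).1 ?_
      rw [hXx]
      exact h2 c

/-- The point is that no listed code is spurious: each one decodes to a transition or state with
numbers below `stateBound`. -/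
theorem hasCode_typeAut (hD : Lists D (Transition.code α κ γ) 𝒜.trans) {s : TransMonoid Q}
    (hs : s.HasCode κ ls) : (typeAut T I hD ls le).HasCode α (Equiv.refl _) (Equiv.refl _)
      (typeCode T ((k, n, m, I, D), ls, le)) := by
  refine ⟨⟨_, _, rfl, fun y => ?_, fun y => ?_⟩, fun y => ?_⟩
  · constructor
    · intro hy
      obtain ⟨x, hx, hxI, X, hX, rfl⟩ := mem_initCodes.1 hy
      obtain ⟨p₀, q, hpq, rfl⟩ := (mem_list_of_lists hs).1 hx
      exact ⟨⟨_, stateNum_lt (initState_mem (κ q).2 hX)⟩, hy, rfl⟩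
    · rintro ⟨p, hp, rfl⟩
      exact hp
  · constructor
    · intro hy
      suffices h : ∃ t : Transition A (Fin (stateBound T n m)) (Fin m),
          t.code α (Equiv.refl _) (Equiv.refl _) = y by
        obtain ⟨t, rfl⟩ := h
        exact ⟨t, hy, rfl⟩
      rcases mem_transCodes.1 hy with ⟨st, hst, y, hyD, -, rfl⟩ | ⟨st, hst, -, rfl⟩
      · obtain ⟨t₀, -, rfl⟩ := (hD y).1 hyD
        exact ⟨⟨⟨_, stateNum_lt hst⟩, t₀.label, fun i =>
          bif !decide ((i : ℕ) ∈ st.2.2.1) || decide ((i : ℕ) ∈ st.2.2.2.1)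
          then t₀.op (γ.symm i) else .nil, ⟨_, stateNum_lt (nextState_code_mem hst t₀)⟩⟩,
          code_eq_liftTrans_iff.2 ⟨rfl, rfl, fun c => by simp, rfl⟩⟩
      · exact ⟨⟨⟨_, stateNum_lt hst⟩, none, fun i => T.finalOp (decide ((i : ℕ) ∈ st.2.2.1)),
          ⟨0, Nat.succ_pos _⟩⟩, (code_eq_finalTrans_iff (γ := Equiv.refl (Fin m))).2
            ⟨rfl, rfl, fun c => rfl, rfl⟩⟩
    · rintro ⟨t, ht, rfl⟩
      exact ht
  · constructor
    · intro hy
      exact ⟨⟨0, Nat.succ_pos _⟩, rfl, (List.mem_singleton.1 hy).symm⟩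
    · rintro ⟨p, hp, rfl⟩
      exact List.mem_singleton.2 hp

theorem exists_typeAut (T : Mode) {s e : TransMonoid Q} {c : AutCode} (hc : 𝒜.HasCode α κ γ c)
    (hs : s.HasCode κ ls) (he : e.HasCode κ le) :
    ∃ (n' m' : ℕ) (ℬ : FinCounterAutomaton A (Fin n') (Fin m')),
      ℬ.HasCode α (Equiv.refl (Fin n')) (Equiv.refl (Fin m')) (typeCode T (c, ls, le)) ∧
      ℬ.profLang T = 𝒜.typeLang s e T := by
  obtain ⟨I, D, rfl, hI, hD⟩ := hc
  exact ⟨_, _, typeAut T I hD ls le, hasCode_typeAut hD hs,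
    FinCounterAutomaton.profLang_eq _ 𝒜 T s e (acceptLang_typeAut hI hD hs he)⟩

theorem exists_lists {X Y : Type*} (f : X → Y) {s : Set X} (hs : s.Finite) : ∃ l, Lists l f s :=
  ⟨(hs.image f).toFinset.toList, fun y => by simp⟩

/-- Finiteness provides some enumerations and codes, and the coded construction then supplies the
automaton. -/
theorem isTRegular_typeLang [Finite A] [Finite Q] [Finite Γ] (𝒜 : CounterAutomaton A Q Γ)
    (T : Mode) (s e : TransMonoid Q) : IsTRegular T (𝒜.typeLang s e T) := by
  obtain ⟨k, ⟨α⟩⟩ := Finite.exists_equiv_fin A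
  obtain ⟨n, ⟨κ⟩⟩ := Finite.exists_equiv_fin Q
  obtain ⟨m, ⟨γ⟩⟩ := Finite.exists_equiv_fin Γ
  have hop : Finite CounterOp := 
    Set.finite_univ_iff.1 ((Set.toFinite {.nil, .inc, .reset}).subset (by
      rintro (_ | _ | _) <;> simp))
  have htr : Finite (Transition A Q Γ) := by
    refine Finite.of_injective (fun t => (t.src, t.label, t.op, t.tgt)) ?_
    rintro ⟨_, _, _, _⟩ ⟨_, _, _, _⟩ h
    simpa using h
  obtain ⟨I, hI⟩ := exists_lists (fun q => (κ q : ℕ)) 𝒜.init.toFinite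
  obtain ⟨D, hD⟩ := exists_lists (Transition.code α κ γ) 𝒜.trans.toFinite
  obtain ⟨ls, hls⟩ := exists_lists (fun x : Q × Q => ((κ x.1 : ℕ), (κ x.2 : ℕ)))
    (Set.toFinite {x | x ∈ s})
  obtain ⟨le, hle⟩ := exists_lists (fun x : Q × Q => ((κ x.1 : ℕ), (κ x.2 : ℕ)))
    (Set.toFinite {x | x ∈ e})
  obtain ⟨n', m', ℬ, -, hℬ⟩ := exists_typeAut (𝒜 := 𝒜) (α := α) (κ := κ) (γ := γ) T
    ⟨I, D, rfl, hI, hD⟩ hls hle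
  exact ⟨Fin n', Fin m', inferInstance, inferInstance, ℬ, hℬ⟩

end Recognition

/-! ### Computability of the construction -/

section Computability

open Primrec

variable {σ β : Type*} [Primcodable σ] [Primcodable β]

theorem primrec_filter {f : σ → List β} {p : σ → β → Prop} [∀ x, DecidablePred (p x)]
    (hf : Primrec f) (hp : PrimrecPred fun x : σ × β => p x.1 x.2) :
    Primrec fun x => (f x).filter fun b => p x b := by
  refine (listFilterMap (g := fun x b => if p x b then some b else none) hf
    (.mk (Primrec.ite hp (option_some.comp snd) (const none)))).of_eq fun x => ?_
  rw [← List.filterMap_eq_filter]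
  refine congrFun (congrArg _ (funext fun b => ?_)) _
  simp [Option.guard]

theorem primrecPred_mem {f : σ → β} {g : σ → List β} (hf : Primrec f) (hg : Primrec g) :
    PrimrecPred fun x => f x ∈ g x :=
  ((PrimrecRel.exists_mem_list (R := fun a b : β => a = b) Primrec.eq).comp hg hf).of_eq
    fun x => by simp

theorem primrec_pairs : Primrec pairs :=
  list_flatMap list_range (.mk (list_map (list_range.comp fst)
    (.mk (Primrec.pair (snd.comp fst) snd))))

theorem primrec_canonRel {f : σ → ℕ} {g : σ → List (ℕ × ℕ)} (hf : Primrec f) (hg : Primrec g) :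
    Primrec fun x => canonRel (f x) (g x) :=
  primrec_filter (primrec_pairs.comp hf) (primrecPred_mem snd (hg.comp fst))

theorem primrec_stepRel {f : σ → List TransCode} {l : σ → Option ℕ} {g : σ → List (ℕ × ℕ)}
    (hf : Primrec f) (hl : Primrec l) (hg : Primrec g) :
    Primrec fun x => stepRel (f x) (l x) (g x) := by
  refine list_flatMap hg (.mk (list_map (primrec_filter (hf.comp fst) (PrimrecPred.and ?_ ?_))
    (.mk ?_)))
  · exact Primrec.eq.comp (fst.comp snd) (snd.comp (snd.comp fst))
  · exact Primrec.eq.comp (fst.comp (snd.comp snd)) (hl.comp (fst.comp fst))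
  · exact Primrec.pair (fst.comp (snd.comp fst)) (snd.comp (snd.comp (snd.comp snd)))

theorem primrec_epsClosure {f : σ → ℕ} {d : σ → List TransCode} {g : σ → List (ℕ × ℕ)}
    (hf : Primrec f) (hd : Primrec d) (hg : Primrec g) :
    Primrec fun x => epsClosure (f x) (d x) (g x) :=
  nat_iterate hf hg (.mk (list_append.comp snd
    (primrec_stepRel (hd.comp fst) (const none) snd)))

theorem primrec_trackNil {f : σ → ℕ} {d : σ → List TransCode} (hf : Primrec f) (hd : Primrec d) :
    Primrec fun x => trackNil (f x) (d x) :=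
  primrec_canonRel hf (primrec_epsClosure hf hd
    (list_map (list_range.comp hf) (.mk (Primrec.pair snd snd))))

theorem primrec_track {f : σ → ℕ} {d : σ → List TransCode} {l : σ → Option ℕ}
    {g : σ → List (ℕ × ℕ)} (hf : Primrec f) (hd : Primrec d) (hl : Primrec l) (hg : Primrec g) :
    Primrec fun x => track (f x) (d x) (l x) (g x) :=
  Primrec.ite (Primrec.eq.comp hl (const none)) hg
    (primrec_canonRel hf (primrec_epsClosure hf hd (primrec_stepRel hd hl hg)))

theorem primrec_filterings : Primrec (filterings (X := β)) :=
  list_foldr (h := fun _ p => p.2 ++ p.2.map (p.1 :: ·)) Primrec.id (const [[]])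
    (.mk (list_append.comp (snd.comp snd)
      (list_map (snd.comp snd) (.mk (list_cons.comp (fst.comp (snd.comp fst)) snd)))))

theorem primrec_maskCodes (T : Mode) : Primrec (maskCodes T) := by
  cases T with
  | B => exact const [[]]
  | S => exact primrec_filterings.comp list_range

theorem primrec_stateCodes (T : Mode) : Primrec₂ (stateCodes T) := by
  refine .mk (list_flatMap (list_range.comp fst) (.mk ?_))
  refine list_flatMap (list_range.comp (fst.comp fst)) (.mk ?_)
  refine list_flatMap ((primrec_maskCodes T).comp (snd.comp (fst.comp fst))) (.mk ?_)
  refine list_flatMap (primrec_filterings.comp (list_range.comp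
    (snd.comp (fst.comp (fst.comp fst))))) (.mk ?_)
  refine list_map (primrec_filterings.comp (primrec_pairs.comp
    (fst.comp (fst.comp (fst.comp (fst.comp fst)))))) (.mk ?_)
  exact Primrec.pair (snd.comp (fst.comp (fst.comp (fst.comp fst))))
    (Primrec.pair (snd.comp (fst.comp (fst.comp fst)))
      (Primrec.pair (snd.comp (fst.comp fst)) (Primrec.pair (snd.comp fst) snd)))

theorem primrec_stateNum : Primrec stateNum :=
  Primrec.succ.comp Primrec.encode

theorem primrec_stateBound (T : Mode) : Primrec₂ (stateBound T) :=
  .mk (Primrec.succ.comp (list_foldr (h := fun _ p => max (stateNum p.1) p.2)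
    (primrec_stateCodes T) (const 0)
    (.mk (nat_max.comp (primrec_stateNum.comp (fst.comp snd)) (snd.comp snd)))))

theorem primrec_nextState {f g : σ → ℕ} {d : σ → List TransCode} {st : σ → StateCode}
    {t : σ → TransCode} (hf : Primrec f) (hg : Primrec g) (hd : Primrec d) (hst : Primrec st)
    (ht : Primrec t) : Primrec fun x => nextState (f x) (g x) (d x) (st x) (t x) := by
  refine Primrec.pair (fst.comp hst) (Primrec.pair (snd.comp (snd.comp (snd.comp ht)))
    (Primrec.pair (fst.comp (snd.comp (snd.comp hst))) (Primrec.pair ?_ ?_)))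
  · refine primrec_filter (list_range.comp hg) (PrimrecPred.or ?_ ?_)
    · exact primrecPred_mem snd (fst.comp (snd.comp (snd.comp (snd.comp (hst.comp fst)))))
    · exact Primrec.eq.comp ((list_getD 0).comp (fst.comp (snd.comp (snd.comp (ht.comp fst)))) snd)
        (const 2)
  · exact primrec_track hf hd (fst.comp (snd.comp ht)) (snd.comp (snd.comp (snd.comp (snd.comp
      hst))))

theorem primrec_liftTrans {f g : σ → ℕ} {d : σ → List TransCode} {st : σ → StateCode}
    {t : σ → TransCode} (hf : Primrec f) (hg : Primrec g) (hd : Primrec d) (hst : Primrec st)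
    (ht : Primrec t) : Primrec fun x => liftTrans (f x) (g x) (d x) (st x) (t x) := by
  refine Primrec.pair (primrec_stateNum.comp hst) (Primrec.pair (fst.comp (snd.comp ht))
    (Primrec.pair (list_map (list_range.comp hg) (.mk (Primrec.ite (PrimrecPred.and ?_ ?_)
      (const 0) ?_))) (primrec_stateNum.comp (primrec_nextState hf hg hd hst ht))))
  · exact primrecPred_mem snd (fst.comp (snd.comp (snd.comp (hst.comp fst))))
  · exact (primrecPred_mem snd (fst.comp (snd.comp (snd.comp (snd.comp (hst.comp fst)))))).not
  · exact (list_getD 0).comp (fst.comp (snd.comp (snd.comp (ht.comp fst)))) snd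

theorem primrec_finalOpCode (T : Mode) {f : σ → List ℕ} {g : σ → ℕ} (hf : Primrec f)
    (hg : Primrec g) : Primrec fun x => finalOpCode T (f x) (g x) := by
  cases T with
  | B => exact const 2
  | S => exact Primrec.ite (primrecPred_mem hg hf) (const 2) (const 0)

theorem primrec_finalTrans (T : Mode) {g : σ → ℕ} {st : σ → StateCode} (hg : Primrec g)
    (hst : Primrec st) : Primrec fun x => finalTrans T (g x) (st x) :=
  Primrec.pair (primrec_stateNum.comp hst) (Primrec.pair (const none) (Primrec.pair
    (list_map (list_range.comp hg) (.mk (primrec_finalOpCode T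
      (fst.comp (snd.comp (snd.comp (hst.comp fst)))) snd))) (const 0)))

theorem primrecPred_isLoopEnd {f g : σ → ℕ} {le : σ → List (ℕ × ℕ)} {st : σ → StateCode}
    (hf : Primrec f) (hg : Primrec g) (hle : Primrec le) (hst : Primrec st) :
    PrimrecPred fun x => IsLoopEnd (f x) (g x) (le x) (st x) := by
  refine PrimrecPred.and ?_ (PrimrecPred.and ?_ ?_)
  · exact Primrec.eq.comp (fst.comp (snd.comp hst)) (fst.comp hst)
  · exact Primrec.eq.comp (primrec_filter (list_range.comp hg)
      (primrecPred_mem snd (fst.comp (snd.comp (snd.comp (snd.comp (hst.comp fst)))))))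
      (list_range.comp hg)
  · exact Primrec.eq.comp (snd.comp (snd.comp (snd.comp (snd.comp hst))))
      (primrec_canonRel hf hle)

theorem primrec_transCodes (T : Mode) {f g : σ → ℕ} {d : σ → List TransCode}
    {le : σ → List (ℕ × ℕ)} (hf : Primrec f) (hg : Primrec g) (hd : Primrec d) (hle : Primrec le) :
    Primrec fun x => transCodes T (f x) (g x) (d x) (le x) := by
  have hst : Primrec fun x => stateCodes T (f x) (g x) := (primrec_stateCodes T).comp hf hg
  refine list_append.comp (list_flatMap hst (.mk (list_map (primrec_filter (hd.comp fst) ?_)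
    (.mk ?_)))) (list_map (primrec_filter hst ?_) (.mk ?_))
  · exact Primrec.eq.comp (fst.comp snd) (fst.comp (snd.comp (snd.comp fst)))
  · exact primrec_liftTrans (hf.comp (fst.comp fst)) (hg.comp (fst.comp fst))
      (hd.comp (fst.comp fst)) (snd.comp fst) snd
  · exact primrecPred_isLoopEnd (hf.comp fst) (hg.comp fst) (hle.comp fst) snd
  · exact primrec_finalTrans T (hg.comp fst) snd

theorem primrec_initCodes (T : Mode) {f g : σ → ℕ} {i : σ → List ℕ} {d : σ → List TransCode}
    {ls : σ → List (ℕ × ℕ)} (hf : Primrec f) (hg : Primrec g) (hi : Primrec i) (hd : Primrec d)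
    (hls : Primrec ls) : Primrec fun x => initCodes T (f x) (g x) (i x) (d x) (ls x) := by
  refine list_flatMap (primrec_filter hls (primrecPred_mem (fst.comp snd) (hi.comp fst)))
    (.mk (list_map ((primrec_maskCodes T).comp (hg.comp fst)) (.mk (primrec_stateNum.comp ?_))))
  exact Primrec.pair (snd.comp (snd.comp fst)) (Primrec.pair (snd.comp (snd.comp fst))
    (Primrec.pair snd (Primrec.pair (const [])
      (primrec_trackNil (hf.comp (fst.comp fst)) (hd.comp (fst.comp fst))))))

theorem primrec_typeCode (T : Mode) : Primrec (typeCode T) := by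
  have hn : Primrec fun x : AutCode × List (ℕ × ℕ) × List (ℕ × ℕ) => x.1.2.1 :=
    fst.comp (snd.comp fst)
  have hm : Primrec fun x : AutCode × List (ℕ × ℕ) × List (ℕ × ℕ) => x.1.2.2.1 :=
    fst.comp (snd.comp (snd.comp fst))
  have hI : Primrec fun x : AutCode × List (ℕ × ℕ) × List (ℕ × ℕ) => x.1.2.2.2.1 :=
    fst.comp (snd.comp (snd.comp (snd.comp fst)))
  have hD : Primrec fun x : AutCode × List (ℕ × ℕ) × List (ℕ × ℕ) => x.1.2.2.2.2 :=
    snd.comp (snd.comp (snd.comp (snd.comp fst)))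
  exact Primrec.pair (Primrec.pair (fst.comp fst) (Primrec.pair ((primrec_stateBound T).comp hn hm)
    (Primrec.pair hm (Primrec.pair (primrec_initCodes T hn hm hI hD (fst.comp snd))
      (primrec_transCodes T hn hm hD (snd.comp snd)))))) (const [0])

end Computability

end CounterAut

open CounterAut in
theorem mainTheorem3 (T : Mode) :
    ∃ F : AutCode × List (ℕ × ℕ) × List (ℕ × ℕ) → FinAutCode, Computable F ∧
      ∀ (A Q Γ : Type*) [Finite A] [Finite Q] [Finite Γ]
        (𝒜 : CounterAutomaton A Q Γ) (s e : TransMonoid Q), IsLinkedPair s e →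
        ∃ M : Set (ProWord A),
          IsTRegular T M ∧
          M ⊆ profClosure {x : List A | 𝒜.h x = e} ∧
          (∀ (u : ℕ → A) (W : ℕ → List A), IsDecomposition W u → HasType 𝒜.h W s e →
            [u ∈ 𝒜.omegaLang T,
              ∃ Z, IsGrouping W Z ∧ ∃ z ∈ M, StronglyConvergesTo Z z,
              ∃ Z, IsGrouping W Z ∧ ∃ z ∈ M, ConvergesTo Z z].TFAE) ∧
          ∀ (k n m : ℕ) (α : A ≃ Fin k) (κ : Q ≃ Fin n) (γ : Γ ≃ Fin m)
            (c : AutCode) (ls le : List (ℕ × ℕ)),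
            𝒜.HasCode α κ γ c → s.HasCode κ ls → e.HasCode κ le →
            ∃ (n' m' : ℕ) (ℬ : FinCounterAutomaton A (Fin n') (Fin m')),
              ℬ.HasCode α (Equiv.refl (Fin n')) (Equiv.refl (Fin m')) (F (c, ls, le)) ∧
              ℬ.profLang T = M :=
  -- The language `typeLang` does not depend on enumerations, so one `M` serves all codes.
  ⟨typeCode T, (primrec_typeCode T).to_comp, fun _ _ _ _ _ _ 𝒜 s e _ =>
    ⟨𝒜.typeLang s e T, isTRegular_typeLang 𝒜 T s e, 𝒜.typeLang_subset T s e,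
      fun _ _ hW ht => tfae_mem_omegaLang 𝒜 T hW ht,
      fun _ _ _ _ _ _ _ _ _ hc hs he => exists_typeAut T hc hs he⟩⟩
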